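/- Let $\mathcal Z$ be a finite set with $|\mathcal Z|$ elements, let $P_Z$ be a probability distribution on $\mathcal Z$, let $N\ge 1$, and let $S=(Z_1,\dots,Z_N)$ be a dataset of $N$ instances sampled i.i.d. from $P_Z$. Let $W$ be a hypothesis, with values in a measurable space $\mathcal W$, produced from $S$ by a randomized algorithm $\mathbb A$; that is, $P_{W|S=s}=\mathbb A(s)$ for a Markov kernel $\mathbb A$ from $\mathcal Z^N$ to $\mathcal W$ such that $\mathbb A(s)$ does not change when the $N$ instances of $s$ are permuted. Let $I(S;W)=D_{\mathrm{KL}}(P_{S,W}\,\|\,P_S\times P_W)$ be the mutual information, and let $\log$ be the natural logarithm. Call two datasets $s,s'\in\mathcal Z^N$ neighbors if $\frac12\sum_{a\in\mathcal Z}|N(a|s)-N(a|s')|=1$, where $N(a|s)$ is the number of occurrences of $a$ in $s$ (so that, up to order, they differ in exactly one instance). For $\epsilon\ge 0$, $\mathbb A$ is $\epsilon$-DP if $\mathbb A(s)(B)\le e^{\epsilon}\,\mathbb A(s')(B)$ for all neighbors $s,s'$ and all measurable $B\subseteq\mathcal W$. For probability distributions $P,Q$ on the same measurable space and $\alpha\in[0,1]$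 let $T(P,Q)(\alpha)=\inf\{1-\mathbb E_Q[\varphi] : \varphi \text{ measurable},\ 0\le\varphi\le 1,\ \mathbb E_P[\varphi]\le\alpha\}$. For $\mu\ge 0$, $\mathbb A$ is $\mu$-GDP if $T(\mathbb A(s),\mathbb A(s'))(\alpha)\ge T(\mathcal N(0,1),\mathcal N(\mu,1))(\alpha)$ for all neighbors $s,s'$ and all $\alpha\in[0,1]$. Then the following hold. 1. If $\mathbb A$ is $\epsilon$-DP and $\epsilon\le 2$, then $$I(S;W)\le |\mathcal Z|\log\bigl(1+e\,\epsilon\sqrt{N\log N}\bigr)+2|\mathcal Z|\frac{\epsilon}{N},$$ while if $\mathbb A$ is $\epsilon$-DP and $\epsilon>2$, then $$I(S;W)\le |\mathcal Z|\log\bigl(1+2\sqrt{N\log N}\bigr)+2|\mathcal Z|\frac{\epsilon}{N}.$$ 2. If $\mathbb A$ is $\mu$-GDP and $\mu\le 2/\sqrt{|\mathcal Z|}$, then $$I(S;W)\le \frac{|\mathcal Z|}{2}\log\bigl(1+e\,|\mathcal Z|\,\mu^2N\log N\bigr)+|\mathcal Z|\mu^2,$$ while if $\mathbb A$ is $\mu$-GDP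 and $\mu>2/\sqrt{|\mathcal Z|}$, then $$I(S;W)\le |\mathcal Z|\log\bigl(1+2\sqrt{N\log N}\bigr)+|\mathcal Z|\mu^2.$$ -/

import Mathlib

open MeasureTheory ProbabilityTheory InformationTheory
open scoped ENNReal

noncomputable section

namespace PrivateLearning

/-- The mutual information `I(X;Y) = KL(P_{X,Y} ‖ P_X × P_Y)` of two random variables defined on
the probability space `(Ω, P)`; it takes the value `∞` when the divergence is infinite. -/
def mutualInfo {Ω 𝓧 𝓨 : Type*} [MeasurableSpace Ω] [MeasurableSpace 𝓧] [MeasurableSpace 𝓨]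
    (X : Ω → 𝓧) (Y : Ω → 𝓨) (P : Measure Ω) : ℝ≥0∞ :=
  klDiv (P.map (fun ω => (X ω, Y ω))) ((P.map X).prod (P.map Y))

/-- `N(a|s)`: the number of occurrences of the symbol `a` in `s`. -/
def symbolCount {𝓩 : Type*} {N : ℕ} (s : Fin N → 𝓩) (a : 𝓩) : ℕ :=
  open Classical in (Finset.univ.filter (fun i => s i = a)).card

/-- The distance `d(s,s') = (1/2) ∑_a |N(a|s) - N(a|s')|` between two datasets of size `N`, that
is, the least number of instances of `s` that have to be changed to obtain `s'` up to order. -/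
def datasetDist {𝓩 : Type*} [Fintype 𝓩] {N : ℕ} (s s' : Fin N → 𝓩) : ℝ :=
  (1 / 2) * ∑ a : 𝓩, |(symbolCount s a : ℝ) - (symbolCount s' a : ℝ)|

/-- Two datasets are neighbors if they are at distance one. -/
def Neighboring {𝓩 : Type*} [Fintype 𝓩] {N : ℕ} (s s' : Fin N → 𝓩) : Prop :=
  datasetDist s s' = 1

/-- The trade-off function `T(P,Q)` of two probability distributions: `tradeoff P Q α` is the
smallest type II error among all (randomized) tests `φ` of `P` against `Q` whose type I error is
at most `α`. -/
def tradeoff {𝓦 : Type*} [MeasurableSpace 𝓦] (P Q : Measure 𝓦) (α : ℝ) : ℝ :=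
  sInf {β : ℝ | ∃ φ : 𝓦 → ℝ, Measurable φ ∧ (∀ w, 0 ≤ φ w ∧ φ w ≤ 1) ∧
    ∫ w, φ w ∂P ≤ α ∧ β = 1 - ∫ w, φ w ∂Q}

/-- `A` depends on its input only as a collection: reordering the instances does not change the
distribution of the output. -/
def PermutationInvariant {𝓩 𝓦 : Type*} [MeasurableSpace 𝓩] [MeasurableSpace 𝓦] {N : ℕ}
    (A : Kernel (Fin N → 𝓩) 𝓦) : Prop :=
  ∀ (σ : Equiv.Perm (Fin N)) (s : Fin N → 𝓩), A (fun i => s (σ i)) = A s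

/-- `ε`-differential privacy. -/
def IsDP {𝓩 𝓦 : Type*} [Fintype 𝓩] [MeasurableSpace 𝓩] [MeasurableSpace 𝓦] {N : ℕ}
    (A : Kernel (Fin N → 𝓩) 𝓦) (ε : ℝ) : Prop :=
  ∀ s s' : Fin N → 𝓩, Neighboring s s' →
    ∀ B : Set 𝓦, MeasurableSet B → A s B ≤ ENNReal.ofReal (Real.exp ε) * A s' B

/-- `μ`-Gaussian differential privacy: telling the outputs of neighboring datasets apart is at
least as hard as telling `N(0,1)` and `N(μ,1)` apart. -/
def IsGDP {𝓩 𝓦 : Type*} [Fintype 𝓩] [MeasurableSpace 𝓩] [MeasurableSpace 𝓦] {N : ℕ}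
    (A : Kernel (Fin N → 𝓩) 𝓦) (μ : ℝ) : Prop :=
  ∀ s s' : Fin N → 𝓩, Neighboring s s' → ∀ α ∈ Set.Icc (0 : ℝ) 1,
    tradeoff (gaussianReal 0 1) (gaussianReal μ 1) α ≤ tradeoff (A s) (A s') α

end PrivateLearning

end

/-!
Write `d` for the number of symbols and `b = √(N log N)`.

If every dataset `s` is assigned one of `K` representatives `r(s)`, then comparing the output law
`A s` with the uniform mixture of the output laws of the representatives gives
`I(S;W) ≤ log K + E[KL(A S ‖ A r(S))]` (`mutualInfo_le_of_cover`), since the true output law is the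
best reference law (`klDiv_prod_snd_le`). Three ingredients make this small.

*Group privacy.* A dataset is determined up to order by its symbol counts, and two datasets are
joined by a chain of neighbors as long as their distance (`datasetDist_induction`). Hence
`KL(A s ‖ A s') ≤ ε d(s,s')` under `ε`-DP. Under `μ`-GDP the Neyman-Pearson lemma puts the
condition into a form that composes along the chain (`GaussianIndist.trans`). The Kullback-Leibler
divergence is a positive mixture of hockey-stick divergences (`klDiv_eq_lintegral_klKernel`), which
the trade-off condition bounds by those of the Gaussian pair; hence
`KL(A s ‖ A s') ≤ μ² d(s,s')² / 2` (`IsGDP.klDiv_le`).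

*Typicality.* By Hoeffding's inequality all counts are within `b` of their means except with
probability `2 d / N²` (`measure_compl_typicalSet_le`). Since the distance is at most `N`, atypical
datasets contribute at most `2 d ε / N`, respectively `d μ²`.

*Quantization.* The cube of typical counts is cut into `K = m ^ d` cubes of side `2 b / m`. Under
`ε`-DP any typical dataset of a cube represents it at cost `d b ε / m`, and `m = ⌈b ε⌉` turns
`log m + b ε / m` into `log (1 + e b ε)` by convexity of the exponential
(`exists_log_add_div_le`). Under `μ`-GDP the cost is quadratic, and the diameter of a cube would
lose a factor of two; a representative chosen for its mean square distance to its cube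
(`exists_mean_sq_dist_le`) has average cost at most `d² μ² b² / (4 m²)`, which leaves enough room
for rounding `m` to an integer (`exists_two_mul_log_add_div_sq_le`). The bounds for large `ε` and
`μ` come from one representative for each of the at most `(1 + 2 b) ^ d` vectors of typical counts,
at no cost.
-/

namespace PrivateLearning

/-! ### Kullback-Leibler divergence and mutual information -/

/-- If `ν ≤ K • Q` then replacing the reference measure `ν` by `Q` costs at most `log K`. -/
lemma klDiv_le_log_add_klDiv {α : Type*} [MeasurableSpace α] (μ ν Q : Measure α)
    [IsProbabilityMeasure μ] [IsProbabilityMeasure ν] [IsProbabilityMeasure Q]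
    {K : ℝ} (hK1 : 1 ≤ K) (hνQ : ν ≤ ENNReal.ofReal K • Q) :
    klDiv μ Q ≤ ENNReal.ofReal (Real.log K) + klDiv μ ν := by
  by_cases hμν : μ ≪ ν
  swap
  · simp [klDiv_of_not_ac hμν]
  have hνQ' : ν ≪ Q := (Measure.absolutelyContinuous_of_le hνQ).trans
    (Measure.smul_absolutelyContinuous)
  have hμQ := hμν.trans hνQ'
  have hg_le : ∀ᵐ x ∂Q, ν.rnDeriv Q x ≤ ENNReal.ofReal K := by
    refine ae_le_of_forall_setLIntegral_le_of_sigmaFinite (Measure.measurable_rnDeriv ν Q)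
      fun s hs _ => ?_
    rw [Measure.setLIntegral_rnDeriv hνQ', setLIntegral_const]
    exact hνQ s
  have hlogK : 0 ≤ Real.log K := Real.log_nonneg hK1
  have hpt : ∀ᵐ x ∂Q, ENNReal.ofReal (klFun (μ.rnDeriv Q x).toReal) + ν.rnDeriv Q x ≤
      ν.rnDeriv Q x * ENNReal.ofReal (klFun (μ.rnDeriv ν x).toReal)
        + ENNReal.ofReal (Real.log K) * μ.rnDeriv Q x + 1 := by
    filter_upwards [hg_le, Measure.rnDeriv_mul_rnDeriv (κ := Q) hμν, Measure.rnDeriv_lt_top ν Q,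
      Measure.rnDeriv_lt_top μ Q] with x hgK hmul hgtop hftop
    set g := (ν.rnDeriv Q x).toReal with hg
    set f := (μ.rnDeriv ν x).toReal with hf
    have hmulR : (μ.rnDeriv Q x).toReal = f * g := by
      rw [← hmul, Pi.mul_apply, ENNReal.toReal_mul]
    have hg0 : 0 ≤ g := ENNReal.toReal_nonneg
    have hf0 : 0 ≤ f := ENNReal.toReal_nonneg
    have hgK' : g ≤ K := by
      rw [hg]
      exact ENNReal.toReal_le_of_le_ofReal (by positivity) hgK
    rw [← ENNReal.ofReal_toReal hgtop.ne, ← ENNReal.ofReal_toReal hftop.ne, ← hg, hmulR,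
      ENNReal.toReal_ofReal (by positivity)]
    have hk1 := klFun_nonneg hf0
    have hk2 : 0 ≤ klFun (f * g) := klFun_nonneg (by positivity)
    rw [← ENNReal.ofReal_add hk2 hg0, ← ENNReal.ofReal_mul hg0, ← ENNReal.ofReal_mul hlogK,
      ← ENNReal.ofReal_add (by positivity) (by positivity), ← ENNReal.ofReal_one,
      ← ENNReal.ofReal_add (by positivity) (by positivity)]
    refine ENNReal.ofReal_le_ofReal ?_
    rcases hf0.eq_or_lt with h | hf1
    · simp [← h, klFun_zero]; linarith
    rcases hg0.eq_or_lt with h | hg1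
    · simp [← h, klFun_zero]
    have h1 : Real.log g ≤ Real.log K := Real.log_le_log hg1 hgK'
    have h2 : 0 ≤ f * g * (Real.log K - Real.log g) :=
      mul_nonneg (by positivity) (by linarith)
    rw [klFun_apply, klFun_apply, Real.log_mul hf1.ne' hg1.ne']
    nlinarith
  have hint := lintegral_mono_ae hpt
  rw [lintegral_add_right _ (Measure.measurable_rnDeriv ν Q),
    lintegral_add_right _ measurable_const,
    lintegral_add_right _ ((Measure.measurable_rnDeriv μ Q).const_mul _),
    lintegral_const_mul _ (Measure.measurable_rnDeriv μ Q), Measure.lintegral_rnDeriv hνQ',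
    Measure.lintegral_rnDeriv hμQ,
    lintegral_rnDeriv_mul hνQ' (by fun_prop), ← klDiv_eq_lintegral_klFun_of_ac hμQ,
    ← klDiv_eq_lintegral_klFun_of_ac hμν] at hint
  simp only [measure_univ, mul_one, lintegral_const] at hint
  rw [add_comm (ENNReal.ofReal _)]
  exact ENNReal.le_of_add_le_add_right ENNReal.one_ne_top hint

/-- The divergence of a joint law from a product law is the average of the divergences of the
conditional laws, when the conditioning variable takes finitely many values. -/
lemma klDiv_compProd_prod_eq_sum {S α : Type*} [Fintype S] [MeasurableSpace S]
    [MeasurableSingletonClass S] [MeasurableSpace α] (p : Measure S) [IsProbabilityMeasure p]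
    (A : Kernel S α) [IsMarkovKernel A] (Q : Measure α) [IsProbabilityMeasure Q]
    (hAQ : ∀ s, A s ≪ Q) :
    klDiv (p ⊗ₘ A) (p.prod Q) = ∑ s, klDiv (A s) Q * p {s} := by
  have hmeas : Measurable (fun x : S × α => (A x.1).rnDeriv Q x.2) :=
    measurable_from_prod_countable_right fun s => Measure.measurable_rnDeriv (A s) Q
  have hdens : p ⊗ₘ A = (p.prod Q).withDensity (fun x => (A x.1).rnDeriv Q x.2) := by
    ext s hs
    rw [withDensity_apply _ hs, Measure.compProd_apply hs, ← lintegral_indicator hs,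
      lintegral_prod _ (hmeas.indicator hs).aemeasurable]
    refine lintegral_congr fun a => ?_
    rw [← Measure.setLIntegral_rnDeriv (hAQ a),
      ← lintegral_indicator (measurable_prodMk_left hs)]
    rfl
  have hac : p ⊗ₘ A ≪ p.prod Q := hdens ▸ withDensity_absolutelyContinuous _ _
  have hder : (p ⊗ₘ A).rnDeriv (p.prod Q) =ᵐ[p.prod Q] fun x => (A x.1).rnDeriv Q x.2 := by
    rw [hdens]; exact Measure.rnDeriv_withDensity _ hmeas
  rw [klDiv_eq_lintegral_klFun_of_ac hac,
    lintegral_congr_ae (g := fun x => ENNReal.ofReal (klFun ((A x.1).rnDeriv Q x.2).toReal))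
      (hder.mono fun x hx => by simp only [hx]),
    lintegral_prod _ (Measurable.aemeasurable (by fun_prop)), lintegral_fintype]
  refine Finset.sum_congr rfl fun s _ => ?_
  rw [klDiv_eq_lintegral_klFun_of_ac (hAQ s)]

/-- Among all product laws `P_X × Q`, the choice `Q = P_Y` is closest to the joint law of
`(X, Y)`. -/
lemma klDiv_prod_snd_le {S α : Type*} [MeasurableSpace S] [StandardBorelSpace S] [Nonempty S]
    [MeasurableSpace α] (ρ : Measure (S × α)) [IsProbabilityMeasure ρ]
    (Q : Measure α) [IsProbabilityMeasure Q] :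
    klDiv ρ (ρ.fst.prod ρ.snd) ≤ klDiv ρ (ρ.fst.prod Q) := by
  set τ := ρ.map Prod.swap with hτ
  have : IsProbabilityMeasure τ := Measure.isProbabilityMeasure_map (by fun_prop)
  have hfst : τ.fst = ρ.snd := by rw [hτ, Measure.fst_map_swap]
  have h1 : klDiv ρ (ρ.fst.prod ρ.snd) ≤ klDiv τ (ρ.snd.prod ρ.fst) := by
    have := klDiv_map_le (μ := τ) (ν := ρ.snd.prod ρ.fst) (measurable_swap)
    rwa [hτ, Measure.map_map measurable_swap measurable_swap, Prod.swap_swap_eq, Measure.map_id,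
      Measure.prod_swap] at this
  have h2 : klDiv τ (Q.prod ρ.fst) ≤ klDiv ρ (ρ.fst.prod Q) := by
    have := klDiv_map_le (μ := ρ) (ν := ρ.fst.prod Q) (measurable_swap)
    rwa [Measure.prod_swap] at this
  refine h1.trans (le_trans ?_ h2)
  -- the chain rule along the second coordinate splits off `klDiv ρ.snd Q`
  have h3 : klDiv τ (Q.prod ρ.fst) = klDiv τ.fst Q + klDiv τ (τ.fst.prod ρ.fst) := by
    have := klDiv_compProd_eq_add τ.fst Q τ.condKernel (Kernel.const α ρ.fst)
    rwa [Measure.disintegrate, Measure.compProd_const, Measure.compProd_const] at this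
  rw [h3, hfst]
  exact le_add_self

/-- One-shot covering bound: if every `s` is assigned one of `K` representatives, the mutual
information is at most `log K` plus the average divergence from the output law of `s` to that of
its representative. -/
theorem mutualInfo_le_of_cover {Ω S 𝓦 κ : Type*} [MeasurableSpace Ω] [Fintype S]
    [MeasurableSpace S] [MeasurableSingletonClass S] [MeasurableSpace 𝓦] [Fintype κ]
    (P : Measure Ω) [IsProbabilityMeasure P] (X : Ω → S) (W : Ω → 𝓦)
    (A : Kernel S 𝓦) [IsMarkovKernel A] (hW : HasCondDistrib W X A P)
    (q : S → κ) (r : κ → S) (c : S → ℝ) (hc0 : ∀ s, 0 ≤ c s)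
    (hc : ∀ s, klDiv (A s) (A (r (q s))) ≤ ENNReal.ofReal (c s)) :
    mutualInfo X W P ≤
      ENNReal.ofReal (Real.log (Fintype.card κ) + ∑ s, c s * (P.map X).real {s}) := by
  have hX := hW.aemeasurable_fst
  have hWm := hW.aemeasurable_snd
  have : IsProbabilityMeasure (P.map X) := Measure.isProbabilityMeasure_map hX
  have hΩ : Nonempty Ω := nonempty_of_isProbabilityMeasure P
  have hS : Nonempty S := hΩ.map X
  have hκ : Nonempty κ := hS.map q
  set K := Fintype.card κ with hK
  have hK1 : 1 ≤ K := Fintype.card_pos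
  have hKtop : (K : ℝ≥0∞) ≠ ∞ := ENNReal.natCast_ne_top K
  have hK0 : (K : ℝ≥0∞) ≠ 0 := by positivity
  set Q : Measure 𝓦 := (K : ℝ≥0∞)⁻¹ • ∑ k, A (r k) with hQ
  have hQprob : IsProbabilityMeasure Q := ⟨by
    simp [hQ, Measure.smul_apply, Measure.finsetSum_apply, ← hK, ENNReal.inv_mul_cancel hK0 hKtop]⟩
  have hle : ∀ k, A (r k) ≤ (K : ℝ≥0∞) • Q := fun k => by
    rw [hQ, smul_smul, ENNReal.mul_inv_cancel hK0 hKtop, one_smul]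
    exact Finset.single_le_sum (f := fun k => A (r k)) (fun _ _ => Measure.zero_le _)
      (Finset.mem_univ k)
  have hkl : ∀ s, klDiv (A s) Q ≤ ENNReal.ofReal (Real.log K + c s) := fun s => by
    rw [ENNReal.ofReal_add (Real.log_nonneg (by exact_mod_cast hK1)) (hc0 s)]
    exact (klDiv_le_log_add_klDiv _ _ _ (K := K) (by exact_mod_cast hK1)
      (by simpa using hle (q s))).trans (by gcongr; exact hc s)
  have hac : ∀ s, A s ≪ Q := fun s => by
    by_contra h
    have := hkl s
    simp [klDiv_of_not_ac h] at this
  have hjoint := hW.map_eq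
  have hfst : ((P.map X) ⊗ₘ A).fst = P.map X := Measure.fst_compProd _ _
  have hsnd : ((P.map X) ⊗ₘ A).snd = P.map W := by
    rw [← hjoint, Measure.snd_map_prodMk₀ hX]
  have hgold := klDiv_prod_snd_le ((P.map X) ⊗ₘ A) Q
  rw [hfst, hsnd] at hgold
  rw [mutualInfo, hjoint]
  refine hgold.trans ?_
  rw [klDiv_compProd_prod_eq_sum _ _ _ hac]
  have hsum1 : ∑ s, (P.map X).real {s} = 1 := by
    rw [sum_measureReal_singleton]; simp
  have hterm : ∀ s, 0 ≤ Real.log K + c s := fun s =>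
    add_nonneg (Real.log_nonneg (by exact_mod_cast hK1)) (hc0 s)
  calc ∑ s, klDiv (A s) Q * (P.map X) {s}
      ≤ ∑ s, ENNReal.ofReal ((Real.log K + c s) * (P.map X).real {s}) := by
        refine Finset.sum_le_sum fun s _ => ?_
        rw [ENNReal.ofReal_mul (hterm s), ofReal_measureReal]
        gcongr
        exact hkl s
    _ = _ := by
        rw [← ENNReal.ofReal_sum_of_nonneg fun s _ => mul_nonneg (hterm s) measureReal_nonneg]
        simp only [add_mul, Finset.sum_add_distrib, ← Finset.mul_sum, hsum1, mul_one]

/-! ### Comparing divergences through hockey-stick divergences -/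

/-- The hockey-stick divergence `∫ (dμ/dν - γ)₊ dν = sup_B (μ(B) - γ ν(B))` of `μ ≪ ν`. -/
noncomputable def hockeyStick {α : Type*} [MeasurableSpace α] (μ ν : Measure α) (γ : ℝ) : ℝ≥0∞ :=
  ∫⁻ x, ENNReal.ofReal ((μ.rnDeriv ν x).toReal - γ) ∂ν

/-- The kernel of the integral representation of `klFun`: the hinge function with kink at `γ` which
vanishes at `1`, weighted with the second derivative `1 / γ` of `klFun`. -/
noncomputable def klKernel (x γ : ℝ) : ℝ≥0∞ :=
  ENNReal.ofReal γ⁻¹ * if 1 ≤ γ then ENNReal.ofReal (x - γ) else ENNReal.ofReal (γ - x)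

lemma measurable_klKernel : Measurable (fun z : ℝ × ℝ => klKernel z.1 z.2) := by
  unfold klKernel
  refine Measurable.mul (by fun_prop) (Measurable.ite ?_ (by fun_prop) (by fun_prop))
  exact measurableSet_le measurable_const measurable_snd

/-- Taylor's formula with integral remainder for `klFun` at `1`, where `klFun` and its derivative
vanish; it includes the boundary point `x = 0`. -/
lemma lintegral_klKernel {x : ℝ} (hx : 0 ≤ x) :
    ∫⁻ γ in Set.Ioi 0, klKernel x γ = ENNReal.ofReal (klFun x) := by
  rcases le_total 1 x with h1 | h1
  · have hint : IntervalIntegrable (fun γ : ℝ => x * γ⁻¹ - 1) volume 1 x :=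
      ContinuousOn.intervalIntegrable (by
        rw [Set.uIcc_of_le h1]
        exact (continuousOn_const.mul (continuousOn_inv₀.mono fun y hy => by
          have := hy.1; simp; linarith)).sub continuousOn_const)
    have hval : ∫ γ in (1 : ℝ)..x, (x * γ⁻¹ - 1) = klFun x := by
      rw [intervalIntegral.integral_sub _ (by simp), intervalIntegral.integral_const_mul,
        integral_inv_of_pos one_pos (by linarith)]
      · simp [klFun_apply]; ring
      · simpa using hint.add (intervalIntegrable_const (c := (1 : ℝ)))
    rw [← hval, intervalIntegral.integral_of_le h1, ofReal_integral_eq_lintegral_ofReal hint.1]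
    · rw [← lintegral_indicator measurableSet_Ioi, ← lintegral_indicator measurableSet_Ioc]
      refine lintegral_congr_ae ?_
      filter_upwards [compl_mem_ae_iff.2 (measure_singleton (1 : ℝ))] with γ hγ
      have hγ' : γ ≠ 1 := hγ
      by_cases h0 : 0 < γ
      · rw [Set.indicator_of_mem (by exact h0), klKernel]
        by_cases hg : 1 ≤ γ
        · rw [if_pos hg]
          by_cases hgx : γ ≤ x
          · rw [Set.indicator_of_mem (Set.mem_Ioc.2 ⟨lt_of_le_of_ne hg hγ'.symm, hgx⟩),
              ← ENNReal.ofReal_mul (by positivity)]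
            congr 1; field_simp
          · rw [Set.indicator_of_notMem (fun h => hgx h.2),
              ENNReal.ofReal_of_nonpos (by linarith : x - γ ≤ 0), mul_zero]
        · rw [if_neg hg, Set.indicator_of_notMem (fun h => hg h.1.le),
            ENNReal.ofReal_of_nonpos (by linarith : γ - x ≤ 0), mul_zero]
      · rw [Set.indicator_of_notMem (by exact h0), Set.indicator_of_notMem (fun h => h0 (by
          have := h.1; linarith))]
    · refine (ae_restrict_iff' measurableSet_Ioc).2 (ae_of_all _ fun γ hγ => ?_)
      have : 0 < γ := by have := hγ.1; linarith
      have h2 : 1 ≤ x * γ⁻¹ := by rw [← div_eq_mul_inv, one_le_div this]; exact hγ.2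
      simpa using h2
  · have hint0 : IntervalIntegrable (fun γ : ℝ => x * γ⁻¹) volume x 1 := by
      rcases hx.eq_or_lt with h | h
      · simp [← h]
      · refine ContinuousOn.intervalIntegrable ?_
        rw [Set.uIcc_of_le h1]
        exact continuousOn_const.mul (continuousOn_inv₀.mono fun y hy => by
          have := hy.1; simp; linarith)
    have hint : IntervalIntegrable (fun γ : ℝ => 1 - x * γ⁻¹) volume x 1 :=
      intervalIntegrable_const.sub hint0
    have hval : ∫ γ in x..(1 : ℝ), (1 - x * γ⁻¹) = klFun x := by
      rw [intervalIntegral.integral_sub (by simp) hint0]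
      rcases hx.eq_or_lt with h | h
      · simp [← h, klFun_zero]
      · rw [intervalIntegral.integral_const_mul, integral_inv_of_pos h one_pos]
        simp [klFun_apply]; ring
    rw [← hval, intervalIntegral.integral_of_le h1, ofReal_integral_eq_lintegral_ofReal hint.1]
    · rw [← lintegral_indicator measurableSet_Ioi, ← lintegral_indicator measurableSet_Ioc]
      refine lintegral_congr_ae ?_
      filter_upwards [compl_mem_ae_iff.2 (measure_singleton (1 : ℝ))] with γ hγ
      have hγ' : γ ≠ 1 := hγ
      by_cases h0 : 0 < γ
      · rw [Set.indicator_of_mem (by exact h0), klKernel]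
        by_cases hg : 1 ≤ γ
        · rw [if_pos hg, Set.indicator_of_notMem (fun h => hγ' (le_antisymm h.2 hg)),
            ENNReal.ofReal_of_nonpos (by linarith : x - γ ≤ 0), mul_zero]
        · rw [if_neg hg]
          by_cases hgx : x < γ
          · rw [Set.indicator_of_mem (Set.mem_Ioc.2 ⟨hgx, by linarith⟩),
              ← ENNReal.ofReal_mul (by positivity)]
            congr 1; field_simp
          · rw [Set.indicator_of_notMem (fun h => hgx h.1),
              ENNReal.ofReal_of_nonpos (by linarith : γ - x ≤ 0), mul_zero]
      · rw [Set.indicator_of_notMem (by exact h0), Set.indicator_of_notMem (fun h => h0 (by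
          have := h.1; linarith))]
    · refine (ae_restrict_iff' measurableSet_Ioc).2 (ae_of_all _ fun γ hγ => ?_)
      have : 0 < γ := by have := hγ.1; linarith
      have h2 : x * γ⁻¹ ≤ 1 := by rw [← div_eq_mul_inv, div_le_one this]; exact hγ.1.le
      simpa using h2

lemma klDiv_eq_lintegral_klKernel {α : Type*} [MeasurableSpace α] (P Q : Measure α)
    [IsProbabilityMeasure P] [IsProbabilityMeasure Q] (hPQ : P ≪ Q) :
    klDiv P Q = ∫⁻ γ in Set.Ioi 0, ∫⁻ x, klKernel (P.rnDeriv Q x).toReal γ ∂Q := by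
  rw [klDiv_eq_lintegral_klFun_of_ac hPQ]
  simp_rw [← lintegral_klKernel ENNReal.toReal_nonneg]
  exact lintegral_lintegral_swap (measurable_klKernel.comp
    (((Measure.measurable_rnDeriv P Q).ennreal_toReal.comp measurable_fst).prodMk
      measurable_snd)).aemeasurable

/-- The downward hinges integrate to hockey-stick divergences up to the constant `γ - 1`, so that
hockey-stick divergences also control the part `γ < 1` of the mixture. -/
lemma lintegral_sub_rnDeriv_add_one {α : Type*} [MeasurableSpace α] (P Q : Measure α)
    [IsProbabilityMeasure P] [IsProbabilityMeasure Q] (hPQ : P ≪ Q) {γ : ℝ} (hγ : 0 ≤ γ) :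
    ∫⁻ x, ENNReal.ofReal (γ - (P.rnDeriv Q x).toReal) ∂Q + 1 =
      hockeyStick P Q γ + ENNReal.ofReal γ := by
  have h1 : (1 : ℝ≥0∞) = ∫⁻ x, P.rnDeriv Q x ∂Q := by
    rw [Measure.lintegral_rnDeriv hPQ, measure_univ]
  have h2 : ENNReal.ofReal γ = ∫⁻ _, ENNReal.ofReal γ ∂Q := by simp
  rw [h1, h2, hockeyStick, ← lintegral_add_left (by fun_prop), ← lintegral_add_left (by fun_prop)]
  refine lintegral_congr_ae ?_
  filter_upwards [Measure.rnDeriv_lt_top P Q] with x hx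
  set f := (P.rnDeriv Q x).toReal with hf
  have hf0 : 0 ≤ f := ENNReal.toReal_nonneg
  have hfx : P.rnDeriv Q x = ENNReal.ofReal f := (ENNReal.ofReal_toReal hx.ne).symm
  rw [hfx]
  rcases le_total γ f with h | h
  · rw [ENNReal.ofReal_of_nonpos (by linarith : γ - f ≤ 0), zero_add,
      ← ENNReal.ofReal_add (by linarith) hγ, sub_add_cancel]
  · rw [ENNReal.ofReal_of_nonpos (by linarith : f - γ ≤ 0), zero_add,
      ← ENNReal.ofReal_add (by linarith) hf0, sub_add_cancel]

/-- The Kullback-Leibler divergence is monotone in the hockey-stick divergences, being a positive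
mixture of them. -/
lemma klDiv_le_of_hockeyStick_le {α β : Type*} [MeasurableSpace α] [MeasurableSpace β]
    (P Q : Measure α) [IsProbabilityMeasure P] [IsProbabilityMeasure Q] (hPQ : P ≪ Q)
    (P' Q' : Measure β) [IsProbabilityMeasure P'] [IsProbabilityMeasure Q'] (hPQ' : P' ≪ Q')
    (h : ∀ γ : ℝ, 0 < γ → hockeyStick P Q γ ≤ hockeyStick P' Q' γ) :
    klDiv P Q ≤ klDiv P' Q' := by
  rw [klDiv_eq_lintegral_klKernel P Q hPQ, klDiv_eq_lintegral_klKernel P' Q' hPQ']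
  refine setLIntegral_mono' measurableSet_Ioi fun γ hγ => ?_
  have hγ0 : 0 < γ := hγ
  unfold klKernel
  rw [lintegral_const_mul' _ _ ENNReal.ofReal_ne_top,
    lintegral_const_mul' _ _ ENNReal.ofReal_ne_top]
  gcongr ENNReal.ofReal γ⁻¹ * ?_
  by_cases hg : 1 ≤ γ
  · simp only [if_pos hg]
    exact h γ hγ0
  · simp only [if_neg hg]
    refine ENNReal.le_of_add_le_add_right ENNReal.one_ne_top ?_
    rw [lintegral_sub_rnDeriv_add_one P Q hPQ hγ0.le,
      lintegral_sub_rnDeriv_add_one P' Q' hPQ' hγ0.le]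
    gcongr
    exact h γ hγ0

lemma measure_le_hockeyStick_add {α : Type*} [MeasurableSpace α] (P Q : Measure α)
    [IsProbabilityMeasure P] [IsProbabilityMeasure Q] (hPQ : P ≪ Q) (γ : ℝ)
    (B : Set α) : P B ≤ hockeyStick P Q γ + ENNReal.ofReal γ * Q B := by
  calc P B = ∫⁻ x in B, P.rnDeriv Q x ∂Q := (Measure.setLIntegral_rnDeriv hPQ B).symm
    _ ≤ ∫⁻ x in B, (ENNReal.ofReal ((P.rnDeriv Q x).toReal - γ) + ENNReal.ofReal γ) ∂Q := by
        refine lintegral_mono_ae (ae_restrict_of_ae ?_)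
        filter_upwards [Measure.rnDeriv_lt_top P Q] with x hx
        conv_lhs => rw [← ENNReal.ofReal_toReal hx.ne]
        refine le_trans (ENNReal.ofReal_le_ofReal ?_) ENNReal.ofReal_add_le
        linarith
    _ ≤ _ := by
        rw [lintegral_add_right _ measurable_const, setLIntegral_const]
        gcongr
        exact setLIntegral_le_lintegral _ _

/-- The set where the likelihood ratio exceeds `γ` attains the supremum `sup_B (P(B) - γ Q(B))`. -/
lemma hockeyStick_add_eq_measure {α : Type*} [MeasurableSpace α] (P Q : Measure α)
    [IsProbabilityMeasure P] [IsProbabilityMeasure Q] (hPQ : P ≪ Q) {γ : ℝ} (hγ : 0 ≤ γ) :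
    hockeyStick P Q γ + ENNReal.ofReal γ * Q {x | γ < (P.rnDeriv Q x).toReal} =
      P {x | γ < (P.rnDeriv Q x).toReal} := by
  set B := {x | γ < (P.rnDeriv Q x).toReal} with hB
  have hBm : MeasurableSet B := measurableSet_lt measurable_const (by fun_prop)
  rw [← Measure.setLIntegral_rnDeriv hPQ B, ← setLIntegral_const B, hockeyStick,
    ← lintegral_indicator hBm, ← lintegral_indicator hBm, ← lintegral_add_left (by fun_prop)]
  refine lintegral_congr_ae ?_
  filter_upwards [Measure.rnDeriv_lt_top P Q] with x hx
  by_cases hxB : x ∈ B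
  · have : γ < (P.rnDeriv Q x).toReal := hxB
    rw [Set.indicator_of_mem hxB, Set.indicator_of_mem hxB,
      ← ENNReal.ofReal_add (by linarith) hγ, sub_add_cancel, ENNReal.ofReal_toReal hx.ne]
  · have : ¬ γ < (P.rnDeriv Q x).toReal := hxB
    rw [Set.indicator_of_notMem hxB, Set.indicator_of_notMem hxB, add_zero,
      ENNReal.ofReal_of_nonpos (by linarith)]

/-! ### Gaussian differential privacy of two output laws -/

/-- The Gaussian trade-off condition for a pair of laws, in the form that composes: a test which
rejects `P` with at most the probability that `N(0,1)` exceeds `c` rejects `Q` with at most the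
probability that `N(μ,1)` exceeds `c`. -/
def GaussianIndist {α : Type*} [MeasurableSpace α] (μ : ℝ) (P Q : Measure α) : Prop :=
  ∀ B : Set α, MeasurableSet B → ∀ c : ℝ,
    P B ≤ gaussianReal 0 1 (Set.Ici c) → Q B ≤ gaussianReal μ 1 (Set.Ici c)

lemma gaussianReal_Ici (m μ c : ℝ) :
    gaussianReal (m + μ) 1 (Set.Ici c) = gaussianReal m 1 (Set.Ici (c - μ)) := by
  rw [← gaussianReal_map_add_const, Measure.map_apply (by fun_prop) measurableSet_Ici]
  congr 1
  ext x
  simp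

lemma GaussianIndist.trans {α : Type*} [MeasurableSpace α] {μ ν : ℝ} {P Q R : Measure α}
    (h₁ : GaussianIndist μ P Q) (h₂ : GaussianIndist ν Q R) : GaussianIndist (μ + ν) P R := by
  intro B hB c hc
  have h := h₁ B hB c hc
  rw [← zero_add μ, gaussianReal_Ici] at h
  have := h₂ B hB _ h
  rwa [← gaussianReal_Ici, add_comm] at this

lemma GaussianIndist.refl {α : Type*} [MeasurableSpace α] (P : Measure α) :
    GaussianIndist 0 P P := fun _ _ _ h => h

/-- The Neyman-Pearson lemma for a Gaussian shift: no test beats the threshold test. -/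
lemma integral_gaussianReal_le_of_integral_le {μ : ℝ} (hμ : 0 ≤ μ) (c : ℝ) (φ : ℝ → ℝ)
    (hφ : Measurable φ) (hφ01 : ∀ x, 0 ≤ φ x ∧ φ x ≤ 1)
    (h : ∫ x, φ x ∂(gaussianReal 0 1) ≤ (gaussianReal 0 1).real (Set.Ici c)) :
    ∫ x, φ x ∂(gaussianReal μ 1) ≤ (gaussianReal μ 1).real (Set.Ici c) := by
  have hint : ∀ m : ℝ, Integrable (fun x => gaussianPDFReal m 1 x * φ x) := fun m => by
    refine (integrable_gaussianPDFReal m 1).mul_bdd (c := 1) hφ.aestronglyMeasurable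
      (ae_of_all _ fun x => ?_)
    rw [Real.norm_eq_abs, abs_of_nonneg (hφ01 x).1]
    exact (hφ01 x).2
  set ψ : ℝ → ℝ := (Set.Ici c).indicator 1 with hψ
  have hψint : ∀ m : ℝ, Integrable (fun x => gaussianPDFReal m 1 x * ψ x) := fun m => by
    refine (integrable_gaussianPDFReal m 1).mul_bdd (c := 1)
      (measurable_one.indicator measurableSet_Ici).aestronglyMeasurable (ae_of_all _ fun x => ?_)
    by_cases hx : x ∈ Set.Ici c
    · simp [hψ, Set.indicator_of_mem hx]
    · simp [hψ, Set.indicator_of_notMem hx]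
  have hψval : ∀ m : ℝ, (gaussianReal m 1).real (Set.Ici c) = ∫ x, gaussianPDFReal m 1 x * ψ x := by
    intro m
    rw [← integral_indicator_one measurableSet_Ici,
      integral_gaussianReal_eq_integral_smul one_ne_zero]
    rfl
  have hφval : ∀ m : ℝ, ∫ x, φ x ∂(gaussianReal m 1) = ∫ x, gaussianPDFReal m 1 x * φ x := by
    intro m
    rw [integral_gaussianReal_eq_integral_smul one_ne_zero]
    rfl
  rw [hφval, hψval] at h ⊢
  -- the likelihood ratio of the two densities at the threshold
  set k := Real.exp (μ * c - μ ^ 2 / 2) with hk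
  have hratio : ∀ x, gaussianPDFReal μ 1 x =
      gaussianPDFReal 0 1 x * Real.exp (μ * x - μ ^ 2 / 2) := fun x => by
    simp only [gaussianPDFReal, mul_assoc, ← Real.exp_add]
    congr 2
    simp; ring
  have hpt : ∀ x, 0 ≤ (gaussianPDFReal μ 1 x * ψ x - gaussianPDFReal μ 1 x * φ x)
      - k * (gaussianPDFReal 0 1 x * ψ x - gaussianPDFReal 0 1 x * φ x) := fun x => by
    have hp := gaussianPDFReal_nonneg 0 1 x
    have : (gaussianPDFReal μ 1 x * ψ x - gaussianPDFReal μ 1 x * φ x)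
      - k * (gaussianPDFReal 0 1 x * ψ x - gaussianPDFReal 0 1 x * φ x) =
      gaussianPDFReal 0 1 x * ((Real.exp (μ * x - μ ^ 2 / 2) - k) * (ψ x - φ x)) := by
      rw [hratio]; ring
    rw [this]
    refine mul_nonneg hp ?_
    by_cases hx : c ≤ x
    · refine mul_nonneg (sub_nonneg.2 (Real.exp_le_exp.2 (by nlinarith))) ?_
      rw [hψ, Set.indicator_of_mem (by exact hx)]
      simpa using (hφ01 x).2
    · refine mul_nonneg_of_nonpos_of_nonpos
        (sub_nonpos.2 (Real.exp_le_exp.2 (by nlinarith))) ?_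
      rw [hψ, Set.indicator_of_notMem (by exact hx)]
      simpa using (hφ01 x).1
  have hI : 0 ≤ ∫ x, ((gaussianPDFReal μ 1 x * ψ x - gaussianPDFReal μ 1 x * φ x)
      - k * (gaussianPDFReal 0 1 x * ψ x - gaussianPDFReal 0 1 x * φ x)) :=
    integral_nonneg hpt
  have hsub : ∀ m : ℝ, Integrable
      (fun x => gaussianPDFReal m 1 x * ψ x - gaussianPDFReal m 1 x * φ x) :=
    fun m => (hψint m).sub (hint m)
  rw [integral_sub (hsub μ) ((hsub 0).const_mul k),
    integral_sub (hψint μ) (hint μ), integral_const_mul, integral_sub (hψint 0) (hint 0)] at hI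
  have : 0 ≤ k * ((∫ x, gaussianPDFReal 0 1 x * ψ x) - ∫ x, gaussianPDFReal 0 1 x * φ x) :=
    mul_nonneg (Real.exp_pos _).le (sub_nonneg.2 h)
  linarith

/-- Only indicator tests for the pair `P, Q` are needed, while for the Gaussian pair all tests are
dominated by threshold tests. -/
lemma gaussianIndist_of_tradeoff_le {α : Type*} [MeasurableSpace α] {μ : ℝ} (hμ : 0 ≤ μ)
    (P Q : Measure α) [IsProbabilityMeasure P] [IsProbabilityMeasure Q]
    (h : ∀ a ∈ Set.Icc (0 : ℝ) 1,
      tradeoff (gaussianReal 0 1) (gaussianReal μ 1) a ≤ tradeoff P Q a) :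
    GaussianIndist μ P Q := by
  intro B hB c hc
  have hcR : P.real B ≤ (gaussianReal 0 1).real (Set.Ici c) :=
    ENNReal.toReal_mono (measure_ne_top _ _) hc
  have h1 := h ((gaussianReal 0 1).real (Set.Ici c)) ⟨measureReal_nonneg, measureReal_le_one⟩
  have h2 : tradeoff P Q ((gaussianReal 0 1).real (Set.Ici c)) ≤ 1 - Q.real B := by
    refine csInf_le ⟨0, ?_⟩ ⟨B.indicator 1, measurable_one.indicator hB, fun w => ?_, ?_, ?_⟩
    · rintro β ⟨φ, hφm, hφ, -, rfl⟩
      have : ∫ w, φ w ∂Q ≤ ∫ _, (1 : ℝ) ∂Q :=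
        integral_mono_of_nonneg (ae_of_all _ fun w => (hφ w).1) (integrable_const _)
          (ae_of_all _ fun w => (hφ w).2)
      simp at this
      linarith
    · by_cases hw : w ∈ B <;> simp [hw]
    · rwa [integral_indicator_one hB]
    · rw [integral_indicator_one hB]
  have h3 : 1 - (gaussianReal μ 1).real (Set.Ici c) ≤
      tradeoff (gaussianReal 0 1) (gaussianReal μ 1) ((gaussianReal 0 1).real (Set.Ici c)) := by
    refine le_csInf ⟨1, 0, measurable_const, by simp, by simp, by simp⟩ ?_
    rintro β ⟨φ, hφm, hφ, hle, rfl⟩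
    have := integral_gaussianReal_le_of_integral_le hμ c φ hφm hφ hle
    linarith
  have h4 : Q.real B ≤ (gaussianReal μ 1).real (Set.Ici c) := by linarith
  exact (ENNReal.toReal_le_toReal (measure_ne_top _ _) (measure_ne_top _ _)).1 h4

lemma exists_measureReal_Ici_eq (ν : Measure ℝ) [IsProbabilityMeasure ν]
    [NullSingletonClass ν] {q : ℝ} (h0 : 0 < q) (h1 : q < 1) : ∃ c, ν.real (Set.Ici c) = q := by
  have hcont : Continuous (cdf ν) := by
    have hc : Continuous fun b => ∫ _ in (0 : ℝ)..b, (1 : ℝ) ∂ν :=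
      (integrable_const (1 : ℝ)).continuous_primitive 0
    have : (cdf ν : ℝ → ℝ) = fun b => (∫ _ in (0 : ℝ)..b, (1 : ℝ) ∂ν) + cdf ν 0 := by
      ext b
      rw [← intervalIntegral.integral_Iic_sub_Iic (integrable_const _).integrableOn
        (integrable_const _).integrableOn]
      simp [cdf_eq_real]
    rw [this]
    exact hc.add continuous_const
  obtain ⟨c, hc⟩ := mem_range_of_exists_le_of_exists_ge hcont
    (((tendsto_cdf_atBot ν).eventually (ge_mem_nhds (show 0 < 1 - q by linarith))).exists)
    (((tendsto_cdf_atTop ν).eventually (le_mem_nhds (show 1 - q < 1 by linarith))).exists)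
  refine ⟨c, ?_⟩
  rw [cdf_eq_real] at hc
  have : ν.real (Set.Iic c) = ν.real (Set.Iio c) := measureReal_congr Iio_ae_eq_Iic.symm
  rw [← Set.compl_Iio, probReal_compl_eq_one_sub measurableSet_Iio]
  linarith

/-- A null set of `P` is below every Gaussian threshold `c`, and `c` may tend to infinity. -/
lemma GaussianIndist.absolutelyContinuous {α : Type*} [MeasurableSpace α] {μ : ℝ}
    {P Q : Measure α} (h : GaussianIndist μ P Q) : Q ≪ P := by
  refine Measure.AbsolutelyContinuous.mk fun B hB hPB => ?_
  have hle : ∀ n : ℕ, Q B ≤ gaussianReal μ 1 (Set.Ici (n : ℝ)) := fun n =>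
    h B hB n (by rw [hPB]; exact zero_le)
  have hlim : Filter.Tendsto (fun n : ℕ => gaussianReal μ 1 (Set.Ici (n : ℝ))) Filter.atTop
      (nhds (gaussianReal μ 1 (⋂ n : ℕ, Set.Ici (n : ℝ)))) :=
    tendsto_measure_iInter_atTop (fun n => measurableSet_Ici.nullMeasurableSet)
      (fun i j hij => Set.Ici_subset_Ici.2 (by exact_mod_cast hij)) ⟨0, measure_ne_top _ _⟩
  have hemp : (⋂ n : ℕ, Set.Ici (n : ℝ)) = ∅ := by
    ext x
    obtain ⟨n, hn⟩ := exists_nat_gt x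
    simp only [Set.mem_iInter, Set.mem_Ici, Set.mem_empty_iff_false, iff_false, not_forall, not_le]
    exact ⟨n, hn⟩
  rw [hemp, measure_empty] at hlim
  exact le_antisymm (ge_of_tendsto' hlim hle) zero_le

lemma klDiv_gaussianReal_shift (μ : ℝ) :
    gaussianReal μ 1 ≪ gaussianReal 0 1 ∧
      klDiv (gaussianReal μ 1) (gaussianReal 0 1) = ENNReal.ofReal (μ ^ 2 / 2) := by
  set f : ℝ → ℝ := fun x => μ * x - μ ^ 2 / 2 with hf
  have hfm : Measurable fun x => ENNReal.ofReal (Real.exp (f x)) := by fun_prop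
  have hdens : gaussianReal μ 1 =
      (gaussianReal 0 1).withDensity (fun x => ENNReal.ofReal (Real.exp (f x))) := by
    rw [gaussianReal_of_var_ne_zero _ one_ne_zero, gaussianReal_of_var_ne_zero _ one_ne_zero,
      ← withDensity_mul _ (measurable_gaussianPDF 0 1) hfm]
    congr 1
    ext x
    rw [Pi.mul_apply, gaussianPDF, gaussianPDF, ← ENNReal.ofReal_mul (gaussianPDFReal_nonneg _ _ _)]
    congr 1
    simp only [gaussianPDFReal, mul_assoc, ← Real.exp_add]
    congr 2
    simp [hf]; ring
  have hac : gaussianReal μ 1 ≪ gaussianReal 0 1 := by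
    conv_lhs => rw [hdens]
    exact withDensity_absolutelyContinuous _ _
  refine ⟨hac, ?_⟩
  have hder : (gaussianReal μ 1).rnDeriv (gaussianReal 0 1) =ᵐ[gaussianReal 0 1]
      fun x => ENNReal.ofReal (Real.exp (f x)) := by
    conv_lhs => rw [hdens]
    exact Measure.rnDeriv_withDensity _ hfm
  have hllr : llr (gaussianReal μ 1) (gaussianReal 0 1) =ᵐ[gaussianReal μ 1] f := by
    filter_upwards [hac.ae_le hder] with x hx
    rw [llr, hx, ENNReal.toReal_ofReal (Real.exp_pos _).le, Real.log_exp]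
  have hid : Integrable (fun x : ℝ => x) (gaussianReal μ 1) :=
    memLp_one_iff_integrable.1 (memLp_id_gaussianReal 1)
  have hfint : Integrable f (gaussianReal μ 1) := (hid.const_mul μ).sub (integrable_const _)
  rw [klDiv_of_ac_of_integrable hac (hfint.congr hllr.symm), integral_congr_ae hllr, hf,
    integral_sub (hid.const_mul μ) (integrable_const _), integral_const_mul,
    integral_id_gaussianReal]
  simp
  congr 1; ring

/-- The hockey-stick divergences of two laws satisfying the Gaussian trade-off condition are at
most those of the Gaussian pair, hence so is the Kullback-Leibler divergence. -/
lemma GaussianIndist.klDiv_le {α : Type*} [MeasurableSpace α] {μ : ℝ}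
    {P Q : Measure α} [IsProbabilityMeasure P] [IsProbabilityMeasure Q]
    (h : GaussianIndist μ Q P) : klDiv P Q ≤ ENNReal.ofReal (μ ^ 2 / 2) := by
  obtain ⟨hacG, hkl⟩ := klDiv_gaussianReal_shift μ
  have hac := h.absolutelyContinuous
  rw [← hkl]
  refine klDiv_le_of_hockeyStick_le _ _ hac _ _ hacG fun γ hγ => ?_
  set B := {x | γ < (P.rnDeriv Q x).toReal} with hB
  have hBm : MeasurableSet B := measurableSet_lt measurable_const (by fun_prop)
  have hPB := hockeyStick_add_eq_measure P Q hac hγ.le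
  rw [← hB] at hPB
  -- it suffices to match the optimal set `B` by a set for the Gaussian pair
  suffices hs : ∃ B' : Set ℝ, P B ≤ gaussianReal μ 1 B' ∧ gaussianReal 0 1 B' ≤ Q B by
    obtain ⟨B', h1, h2⟩ := hs
    have h3 := measure_le_hockeyStick_add (gaussianReal μ 1) (gaussianReal 0 1) hacG γ B'
    have hfin : ENNReal.ofReal γ * Q B ≠ ∞ :=
      ENNReal.mul_ne_top ENNReal.ofReal_ne_top (measure_ne_top _ _)
    refine ENNReal.le_of_add_le_add_right hfin ?_
    rw [hPB]
    exact h1.trans (h3.trans (by gcongr))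
  rcases measureReal_nonneg.eq_or_lt (a := (0 : ℝ)) (b := Q.real B) with h0 | h0
  · have hQ0 : Q B = 0 := by
      rw [eq_comm, measureReal_eq_zero_iff] at h0; exact h0
    exact ⟨∅, by simp [hac hQ0], by simp⟩
  rcases (measureReal_le_one (μ := Q) (s := B)).eq_or_lt with h1 | h1
  · refine ⟨Set.univ, by simpa using prob_le_one, ?_⟩
    rw [measure_univ, ← ofReal_measureReal, h1, ENNReal.ofReal_one]
  · have := nullSingletonClass_gaussianReal (μ := 0) (v := 1) one_ne_zero
    obtain ⟨c, hc⟩ := exists_measureReal_Ici_eq (gaussianReal 0 1) h0 h1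
    have hc' : gaussianReal 0 1 (Set.Ici c) = Q B := by
      rw [← ofReal_measureReal, hc, ofReal_measureReal]
    exact ⟨Set.Ici c, h B hBm c hc'.ge, hc'.le⟩

/-! ### Datasets up to order and group privacy -/

open Classical in
lemma symbolCount_eq_sum {𝓩 : Type*} {N : ℕ} (s : Fin N → 𝓩) (a : 𝓩) :
    symbolCount s a = ∑ i, if s i = a then 1 else 0 := by
  rw [symbolCount, Finset.card_filter]

lemma exists_perm_of_symbolCount_eq {𝓩 : Type*} {N : ℕ} (s s' : Fin N → 𝓩)
    (h : ∀ a, symbolCount s a = symbolCount s' a) :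
    ∃ σ : Equiv.Perm (Fin N), s = fun i => s' (σ i) := by
  classical
  have e : ∀ a, {i // s i = a} ≃ {i // s' i = a} := fun a => by
    refine Fintype.equivOfCardEq ?_
    have := h a
    rw [symbolCount, symbolCount] at this
    rw [Fintype.card_subtype, Fintype.card_subtype]
    convert this
  exact ⟨Equiv.ofFiberEquiv e, funext fun i => (Equiv.ofFiberEquiv_map e i).symm⟩

open Classical in
lemma symbolCount_update {𝓩 : Type*} {N : ℕ} (s : Fin N → 𝓩) (i : Fin N) (b c : 𝓩) :
    symbolCount (Function.update s i b) c + (if s i = c then 1 else 0) =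
      symbolCount s c + (if b = c then 1 else 0) := by
  rw [symbolCount_eq_sum, symbolCount_eq_sum, ← Finset.add_sum_erase _ _ (Finset.mem_univ i),
    ← Finset.add_sum_erase (a := i) (s := Finset.univ) (f := fun i => if s i = c then 1 else 0)
      (h := Finset.mem_univ i)]
  have : ∑ x ∈ Finset.univ.erase i, (if Function.update s i b x = c then 1 else 0) =
      ∑ x ∈ Finset.univ.erase i, if s x = c then 1 else 0 :=
    Finset.sum_congr rfl fun x hx => by rw [Function.update_of_ne (Finset.ne_of_mem_erase hx)]
  rw [this, Function.update_self]
  ring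

section Datasets

variable {𝓩 𝓦 : Type*} [Fintype 𝓩] {N : ℕ}

lemma sum_symbolCount (s : Fin N → 𝓩) : ∑ a, symbolCount s a = N := by
  classical
  simp_rw [symbolCount_eq_sum]
  rw [Finset.sum_comm]
  simp

/-- The distance of two datasets counts the surplus of symbols of the first one. -/
lemma datasetDist_eq_sum_tsub (s s' : Fin N → 𝓩) :
    datasetDist s s' = ((∑ a, (symbolCount s a - symbolCount s' a) : ℕ) : ℝ) := by
  have h : ∀ a, |(symbolCount s a : ℝ) - symbolCount s' a| =
      2 * ((symbolCount s a - symbolCount s' a : ℕ) : ℝ) - symbolCount s a + symbolCount s' a := by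
    intro a
    rcases le_total (symbolCount s a) (symbolCount s' a) with h | h
    · have h' : (symbolCount s a : ℝ) ≤ symbolCount s' a := by exact_mod_cast h
      rw [abs_of_nonpos (by linarith), Nat.sub_eq_zero_of_le h]
      push_cast; ring
    · have h' : (symbolCount s' a : ℝ) ≤ symbolCount s a := by exact_mod_cast h
      rw [abs_of_nonneg (by linarith), Nat.cast_sub h]
      ring
  have h1 : ∑ a, (symbolCount s a : ℝ) = N := by exact_mod_cast sum_symbolCount s
  have h2 : ∑ a, (symbolCount s' a : ℝ) = N := by exact_mod_cast sum_symbolCount s'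
  rw [datasetDist, Finset.sum_congr rfl fun a _ => h a, Finset.sum_add_distrib,
    Finset.sum_sub_distrib, h1, h2, ← Finset.mul_sum]
  push_cast; ring

lemma datasetDist_nonneg (s s' : Fin N → 𝓩) : 0 ≤ datasetDist s s' := by
  rw [datasetDist]; positivity

lemma datasetDist_comm (s s' : Fin N → 𝓩) : datasetDist s s' = datasetDist s' s := by
  simp_rw [datasetDist, abs_sub_comm]

lemma datasetDist_le (s s' : Fin N → 𝓩) : datasetDist s s' ≤ N := by
  rw [datasetDist_eq_sum_tsub]
  have : ∑ a, (symbolCount s a - symbolCount s' a) ≤ ∑ a, symbolCount s a :=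
    Finset.sum_le_sum fun a _ => Nat.sub_le _ _
  rw [sum_symbolCount] at this
  exact_mod_cast this

lemma datasetDist_sq_le (s s' : Fin N → 𝓩) :
    datasetDist s s' ^ 2 ≤ (Fintype.card 𝓩 : ℝ) / 4 *
      ∑ a, ((symbolCount s a : ℝ) - symbolCount s' a) ^ 2 := by
  have := sq_sum_le_card_mul_sum_sq (s := Finset.univ)
    (f := fun a : 𝓩 => |(symbolCount s a : ℝ) - symbolCount s' a|)
  simp only [sq_abs, Finset.card_univ] at this
  rw [datasetDist, mul_pow]
  linarith

/-- Datasets are joined by chains of neighbors of length equal to their distance. -/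
lemma datasetDist_induction (R : ℕ → (Fin N → 𝓩) → (Fin N → 𝓩) → Prop)
    (hperm : ∀ (σ : Equiv.Perm (Fin N)) s, R 0 (fun i => s (σ i)) s)
    (hstep : ∀ k s t s', Neighboring s t → R k t s' → R (k + 1) s s') (s s' : Fin N → 𝓩) :
    R (∑ a, (symbolCount s a - symbolCount s' a)) s s' := by
  classical
  generalize hk : ∑ a, (symbolCount s a - symbolCount s' a) = k
  induction k generalizing s with
  | zero =>
    have hle : ∀ a ∈ Finset.univ, symbolCount s a ≤ symbolCount s' a := fun a ha =>
      Nat.sub_eq_zero_iff_le.1 (Finset.sum_eq_zero_iff.1 hk a ha)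
    have heq := (Finset.sum_eq_sum_iff_of_le hle).1 (by rw [sum_symbolCount, sum_symbolCount])
    obtain ⟨σ, hσ⟩ := exists_perm_of_symbolCount_eq s s' fun a => heq a (Finset.mem_univ a)
    rw [hσ]
    exact hperm σ s'
  | succ k ih =>
    obtain ⟨a, ha⟩ : ∃ a, symbolCount s' a < symbolCount s a := by
      by_contra! hcon
      simp [Nat.sub_eq_zero_of_le (hcon _)] at hk
    obtain ⟨b, hb⟩ : ∃ b, symbolCount s b < symbolCount s' b := by
      by_contra! hcon
      have := Finset.sum_lt_sum (fun c _ => hcon c) ⟨a, Finset.mem_univ a, ha⟩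
      rw [sum_symbolCount, sum_symbolCount] at this
      exact lt_irrefl _ this
    obtain ⟨i, hi⟩ : ∃ i, s i = a := by
      by_contra! hcon
      have : symbolCount s a = 0 := by simp [symbolCount_eq_sum, hcon]
      omega
    -- replacing a surplus symbol `a` by a missing symbol `b` moves `s` one step towards `s'`
    have hcount := symbolCount_update s i b
    rw [hi] at hcount
    have hab : a ≠ b := by rintro rfl; omega
    have h1 : Neighboring s (Function.update s i b) := by
      rw [Neighboring, datasetDist_eq_sum_tsub]
      have : ∀ c, symbolCount s c - symbolCount (Function.update s i b) c =
          if a = c then 1 else 0 := fun c => by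
        have := hcount c
        split_ifs at this ⊢ <;> first | omega | (subst_vars; exact absurd rfl hab)
      simp [this]
    have h2 : ∑ c, (symbolCount (Function.update s i b) c - symbolCount s' c) = k := by
      have : ∀ c, symbolCount (Function.update s i b) c - symbolCount s' c
          + (if a = c then 1 else 0) = symbolCount s c - symbolCount s' c := fun c => by
        have := hcount c
        split_ifs at this ⊢ <;> subst_vars <;> omega
      have hsum := Finset.sum_congr rfl fun c (_ : c ∈ Finset.univ) => this c
      rw [Finset.sum_add_distrib, hk] at hsum
      simpa using hsum
    exact hstep k _ _ _ h1 (ih _ h2)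

variable [MeasurableSpace 𝓩] [MeasurableSpace 𝓦]

/-- Group privacy for `ε`-differential privacy, in terms of the Kullback-Leibler divergence. -/
lemma IsDP.klDiv_le {A : Kernel (Fin N → 𝓩) 𝓦} [IsMarkovKernel A]
    (hA : PermutationInvariant A) {ε : ℝ} (hε : 0 ≤ ε) (h : IsDP A ε) (s s' : Fin N → 𝓩) :
    klDiv (A s) (A s') ≤ ENNReal.ofReal (ε * datasetDist s s') := by
  have key := datasetDist_induction
    (fun k t t' => ∀ B, MeasurableSet B → A t B ≤ ENNReal.ofReal (Real.exp (ε * k)) * A t' B)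
    (fun σ t B _ => by simp [hA σ t])
    (fun k t u t' htu hu B hB => by
      refine (h t u htu B hB).trans ?_
      calc ENNReal.ofReal (Real.exp ε) * A u B
          ≤ ENNReal.ofReal (Real.exp ε) * (ENNReal.ofReal (Real.exp (ε * k)) * A t' B) := by
            gcongr; exact hu B hB
        _ = _ := by
            rw [← mul_assoc, ← ENNReal.ofReal_mul (Real.exp_pos _).le, ← Real.exp_add]
            congr 3; push_cast; ring) s s'
  rw [datasetDist_eq_sum_tsub]
  have hle : A s ≤ ENNReal.ofReal
      (Real.exp (ε * (∑ a, (symbolCount s a - symbolCount s' a) : ℕ))) • A s' :=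
    Measure.le_iff.2 key
  have := klDiv_le_log_add_klDiv (A s) (A s) (A s') (Real.one_le_exp (by positivity)) hle
  rwa [klDiv_self, add_zero, Real.log_exp] at this

/-- Group privacy for `μ`-Gaussian differential privacy, in terms of the Kullback-Leibler
divergence. -/
lemma IsGDP.klDiv_le {A : Kernel (Fin N → 𝓩) 𝓦} [IsMarkovKernel A]
    (hA : PermutationInvariant A) {μ : ℝ} (hμ : 0 ≤ μ) (h : IsGDP A μ) (s s' : Fin N → 𝓩) :
    klDiv (A s) (A s') ≤ ENNReal.ofReal (μ ^ 2 / 2 * datasetDist s s' ^ 2) := by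
  have key := datasetDist_induction
    (fun k t t' => GaussianIndist (k * μ) (A t) (A t'))
    (fun σ t => by simpa [hA σ t] using GaussianIndist.refl (A t))
    (fun k t u t' htu hu => by
      have := (gaussianIndist_of_tradeoff_le hμ _ _ (h t u htu)).trans hu
      convert this using 1
      push_cast; ring) s' s
  refine key.klDiv_le.trans (le_of_eq ?_)
  rw [datasetDist_comm, datasetDist_eq_sum_tsub]
  congr 1; ring

end Datasets

/-! ### Concentration of the symbol counts -/

/-- The datasets all of whose symbol counts are within `b` of their expectations. -/
def typicalSet {𝓩 : Type*} [MeasurableSpace 𝓩] (PZ : Measure 𝓩) (N : ℕ) (b : ℝ) :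
    Set (Fin N → 𝓩) :=
  {s | ∀ a, |(symbolCount s a : ℝ) - N * PZ.real {a}| ≤ b}

/-- Hoeffding's inequality for the number of occurrences of one symbol, a sum of independent
indicators. -/
lemma measure_symbolCount_deviation_le {Ω 𝓩 : Type*} [MeasurableSpace Ω] [MeasurableSpace 𝓩]
    [MeasurableSingletonClass 𝓩] (P : Measure Ω) [IsProbabilityMeasure P] (PZ : Measure 𝓩)
    {N : ℕ} (Z : Fin N → Ω → 𝓩)
    (hZ_law : ∀ i, HasLaw (Z i) PZ P) (hZ_indep : iIndepFun Z P) (a : 𝓩) {t : ℝ} (ht : 0 ≤ t) :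
    P.real {ω | t ≤ |(symbolCount (fun i => Z i ω) a : ℝ) - N * PZ.real {a}|} ≤
      2 * Real.exp (-2 * t ^ 2 / N) := by
  classical
  set g : 𝓩 → ℝ := ({a} : Set 𝓩).indicator 1 with hg
  have hgm : Measurable g := measurable_one.indicator (measurableSet_singleton a)
  set X : Fin N → Ω → ℝ := fun i ω => g (Z i ω) - PZ.real {a} with hX
  have hXindep : iIndepFun X P :=
    hZ_indep.comp (fun _ z => g z - PZ.real {a}) fun _ => hgm.sub_const _
  have hmean : ∀ i, ∫ ω, g (Z i ω) ∂P = PZ.real {a} := fun i => by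
    rw [← integral_indicator_one (measurableSet_singleton a), ← (hZ_law i).map_eq,
      integral_map (hZ_law i).aemeasurable hgm.aestronglyMeasurable]
  have hsub : ∀ i, HasSubgaussianMGF (X i) ((‖(1 : ℝ) - 0‖₊ / 2) ^ 2) P := fun i => by
    have := hasSubgaussianMGF_of_mem_Icc (μ := P) (X := fun ω => g (Z i ω)) (a := 0) (b := 1)
      (hgm.comp_aemeasurable (hZ_law i).aemeasurable) (ae_of_all _ fun ω => by
        by_cases h : Z i ω ∈ ({a} : Set 𝓩)
        · rw [hg, Set.indicator_of_mem h]; simp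
        · rw [hg, Set.indicator_of_notMem h]; simp)
    simpa only [hX, hmean i] using this
  have hsubneg : ∀ i, HasSubgaussianMGF (fun ω => -X i ω) ((‖(1 : ℝ) - 0‖₊ / 2) ^ 2) P :=
    fun i => (hsub i).neg
  have hsum : ∀ ω, (symbolCount (fun i => Z i ω) a : ℝ) - N * PZ.real {a} = ∑ i, X i ω := by
    intro ω
    simp only [hX, Finset.sum_sub_distrib, Finset.sum_const, Finset.card_univ, Fintype.card_fin,
      nsmul_eq_mul]
    rw [symbolCount_eq_sum, Nat.cast_sum]
    congr 1
    refine Finset.sum_congr rfl fun i _ => ?_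
    simp only [hg, Set.indicator_apply, Set.mem_singleton_iff, Pi.one_apply]
    split_ifs <;> simp
  have hexp : -t ^ 2 / (2 * ((∑ _i : Fin N, (‖(1 : ℝ) - 0‖₊ / 2) ^ 2 : NNReal) : ℝ)) =
      -2 * t ^ 2 / N := by
    simp
    ring
  have h1 := HasSubgaussianMGF.measure_sum_ge_le_of_iIndepFun hXindep
    (s := Finset.univ) (fun i _ => hsub i) ht
  have h2 := HasSubgaussianMGF.measure_sum_ge_le_of_iIndepFun
    (hXindep.comp (fun _ x => -x) fun _ => measurable_neg)
    (s := Finset.univ) (fun i _ => hsubneg i) ht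
  rw [hexp] at h1 h2
  calc P.real {ω | t ≤ |(symbolCount (fun i => Z i ω) a : ℝ) - N * PZ.real {a}|}
      ≤ P.real ({ω | t ≤ ∑ i, X i ω} ∪ {ω | t ≤ ∑ i, -X i ω}) := by
        refine measureReal_mono fun ω hω => ?_
        have hω' : t ≤ |∑ i, X i ω| := by simpa only [Set.mem_ofPred_eq, hsum] using hω
        rcases le_abs.1 hω' with h | h
        · exact Or.inl h
        · right; simpa using h
    _ ≤ _ := (measureReal_union_le _ _).trans (by
        have h2' : P.real {ω | t ≤ ∑ i, -X i ω} ≤ Real.exp (-2 * t ^ 2 / N) := h2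
        linarith)

/-- With the radius `√(N log N)`, atypical datasets have probability at most `2 |𝓩| / N ^ 2`. -/
lemma measure_compl_typicalSet_le {Ω 𝓩 : Type*} [MeasurableSpace Ω] [Fintype 𝓩]
    [MeasurableSpace 𝓩] [MeasurableSingletonClass 𝓩] (P : Measure Ω) [IsProbabilityMeasure P]
    (PZ : Measure 𝓩) {N : ℕ} (hN : 1 ≤ N) (Z : Fin N → Ω → 𝓩)
    (hZ_law : ∀ i, HasLaw (Z i) PZ P) (hZ_indep : iIndepFun Z P) :
    (P.map (fun ω i => Z i ω)).real (typicalSet PZ N (√(N * Real.log N)))ᶜ ≤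
      2 * Fintype.card 𝓩 / (N : ℝ) ^ 2 := by
  have hN' : (1 : ℝ) ≤ N := by exact_mod_cast hN
  have hlog : 0 ≤ Real.log N := Real.log_nonneg hN'
  set b := √(N * Real.log N) with hb
  have hmeas : AEMeasurable (fun ω i => Z i ω) P :=
    aemeasurable_pi_lambda _ fun i => (hZ_law i).aemeasurable
  rw [map_measureReal_apply_of_aemeasurable hmeas (Set.toFinite _).measurableSet]
  have htail : 2 * Real.exp (-2 * b ^ 2 / N) = 2 / (N : ℝ) ^ 2 := by
    rw [hb, Real.sq_sqrt (by positivity)]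
    have : -2 * (N * Real.log N) / N = -(2 * Real.log N) := by field_simp
    have hsq : Real.exp (2 * Real.log N) = (N : ℝ) ^ 2 := by
      rw [two_mul, Real.exp_add, Real.exp_log (by linarith), sq]
    rw [this, Real.exp_neg, hsq, div_eq_mul_inv]
  calc P.real ((fun ω i => Z i ω) ⁻¹' (typicalSet PZ N b)ᶜ)
      ≤ P.real (⋃ a, {ω | b ≤ |(symbolCount (fun i => Z i ω) a : ℝ) - N * PZ.real {a}|}) := by
        refine measureReal_mono fun ω hω => ?_
        simp only [typicalSet, Set.mem_preimage, Set.mem_compl_iff, Set.mem_ofPred_eq, not_forall,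
          not_le] at hω
        obtain ⟨a, ha⟩ := hω
        exact Set.mem_iUnion.2 ⟨a, ha.le⟩
    _ ≤ ∑ a, P.real {ω | b ≤ |(symbolCount (fun i => Z i ω) a : ℝ) - N * PZ.real {a}|} :=
        measureReal_iUnion_fintype_le _
    _ ≤ ∑ _a : 𝓩, 2 / (N : ℝ) ^ 2 := Finset.sum_le_sum fun a _ =>
        (measure_symbolCount_deviation_le P PZ Z hZ_law hZ_indep a (Real.sqrt_nonneg _)).trans_eq
          htail
    _ = _ := by simp; ring

/-! ### The number of cells per coordinate -/

/-- The choice `m = ⌈x⌉` is within the slack left by the `1` on the right: at real `m = x` the left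
side is `log (e * x)`. -/
lemma exists_log_add_div_le {x : ℝ} (hx : 0 ≤ x) :
    ∃ m : ℕ, 1 ≤ m ∧ Real.log m + x / m ≤ Real.log (1 + Real.exp 1 * x) := by
  rcases hx.eq_or_lt with rfl | hx
  · exact ⟨1, le_rfl, by simp⟩
  refine ⟨⌈x⌉₊, Nat.one_le_ceil_iff.2 hx, ?_⟩
  set m : ℝ := (⌈x⌉₊ : ℝ) with hm
  have hm1 : 1 ≤ m := Nat.one_le_cast.2 (Nat.one_le_ceil_iff.2 hx)
  have hm0 : 0 < m := by linarith
  have h1 : x ≤ m := Nat.le_ceil x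
  have h2 : m < x + 1 := Nat.ceil_lt_add_one hx.le
  have hlog : Real.log m + x / m = Real.log (m * Real.exp (x / m)) := by
    rw [Real.log_mul hm0.ne' (Real.exp_pos _).ne', Real.log_exp]
  rw [hlog]
  refine Real.log_le_log (by positivity) ?_
  -- the chord of `exp` on `[0, 1]`
  have hchord : Real.exp (x / m) ≤ (1 - x / m) * 1 + x / m * Real.exp 1 := by
    have := convexOn_exp.2 (Set.mem_univ 0) (Set.mem_univ 1)
      (sub_nonneg.2 ((div_le_one hm0).2 h1)) (by positivity : 0 ≤ x / m) (by ring)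
    simpa using this
  calc m * Real.exp (x / m) ≤ m * ((1 - x / m) * 1 + x / m * Real.exp 1) := by gcongr
    _ = (m - x) + Real.exp 1 * x := by field_simp
    _ ≤ _ := by linarith

/-- The quadratic analogue, with `m = ⌈√z⌉`. The factor `2` on the right is what pays for rounding
`√z` up. -/
lemma exists_two_mul_log_add_div_sq_le {z : ℝ} (hz : 0 ≤ z) :
    ∃ m : ℕ, 1 ≤ m ∧ 2 * Real.log m + z / (m : ℝ) ^ 2 ≤ Real.log (1 + Real.exp 1 * (2 * z)) := by
  rcases hz.eq_or_lt with rfl | hz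
  · exact ⟨1, le_rfl, by simp⟩
  have hs : 0 < √z := Real.sqrt_pos.2 hz
  have hsz : √z ^ 2 = z := Real.sq_sqrt hz.le
  have hm1 : 1 ≤ ⌈√z⌉₊ := Nat.one_le_ceil_iff.2 hs
  refine ⟨⌈√z⌉₊, hm1, ?_⟩
  have h1 := Nat.le_ceil (√z)
  have h2 := Nat.ceil_lt_add_one hs.le
  set m : ℝ := (⌈√z⌉₊ : ℝ) with hm
  have hm1' : 1 ≤ m := Nat.one_le_cast.2 hm1
  have hm0 : 0 < m := by linarith
  have hzm : z ≤ m ^ 2 := by rw [← hsz]; gcongr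
  set t := z / m ^ 2 with ht
  have ht0 : 0 < t := by positivity
  have ht1 : t ≤ 1 := (div_le_one (by positivity)).2 hzm
  have hz' : z = t * m ^ 2 := by rw [ht]; field_simp
  have hlog : 2 * Real.log m + t = Real.log (m ^ 2 * Real.exp t) := by
    rw [Real.log_mul (by positivity) (Real.exp_pos _).ne', Real.log_exp, Real.log_pow]
    norm_num
  rw [hlog]
  refine Real.log_le_log (by positivity) ?_
  have he : 2.7182818283 < Real.exp 1 := Real.exp_one_gt_d9
  have he' : Real.exp 1 < 2.7182818286 := Real.exp_one_lt_d9
  by_cases hm2 : ⌈√z⌉₊ = 1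
  · have hmeq : m = 1 := by rw [hm, hm2]; norm_num
    have hchord : Real.exp t ≤ (1 - t) * 1 + t * Real.exp 1 := by
      have := convexOn_exp.2 (Set.mem_univ 0) (Set.mem_univ 1) (sub_nonneg.2 ht1) ht0.le (by ring)
      simpa using this
    rw [hz', hmeq]
    nlinarith
  · -- for `m ≥ 2` the ratio `t` is at least `1 / 4`, and `exp t ≤ 2 * e * t` on `[1 / 4, 1]`
    have hm2' : (2 : ℝ) ≤ m := by
      have : 2 ≤ ⌈√z⌉₊ := by omega
      exact Nat.ofNat_le_cast.2 this
    have ht4 : 1 / 4 ≤ t := by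
      rw [ht, le_div_iff₀ (by positivity), ← hsz]
      nlinarith
    have hquart : Real.exp (1 / 4) ≤ Real.exp 1 / 2 := by
      have h4 : Real.exp (1 / 4) ^ 4 = Real.exp 1 := by
        rw [← Real.exp_nat_mul]; norm_num
      by_contra! hcon
      have : (Real.exp 1 / 2) ^ 4 < Real.exp (1 / 4) ^ 4 := by gcongr
      rw [h4] at this
      have h3 : (2.7 : ℝ) ^ 3 ≤ Real.exp 1 ^ 3 := by gcongr; linarith
      nlinarith
    have hchord : Real.exp t ≤ (4 / 3 * (1 - t)) * Real.exp (1 / 4) +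
        (4 / 3 * (t - 1 / 4)) * Real.exp 1 := by
      have := convexOn_exp.2 (Set.mem_univ (1 / 4)) (Set.mem_univ 1)
        (by linarith : 0 ≤ 4 / 3 * (1 - t)) (by linarith : 0 ≤ 4 / 3 * (t - 1 / 4)) (by ring)
      have heq : 4 / 3 * (1 - t) * (1 / 4) + 4 / 3 * (t - 1 / 4) * 1 = t := by ring
      simpa only [smul_eq_mul, heq] using this
    have hexp : Real.exp t ≤ 2 * Real.exp 1 * t := by
      have h5 : 4 / 3 * (1 - t) * Real.exp (1 / 4) ≤ 4 / 3 * (1 - t) * (Real.exp 1 / 2) := by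
        gcongr
      nlinarith
    calc m ^ 2 * Real.exp t ≤ m ^ 2 * (2 * Real.exp 1 * t) := by gcongr
      _ = Real.exp 1 * (2 * z) := by rw [hz']; ring
      _ ≤ _ := by linarith

/-! ### Cells and their representatives -/

/-- An interval of half-length `b` splits into `m` cells of half-length `b / m`. -/
lemma exists_cells (c : ℝ) {b : ℝ} (hb : 0 ≤ b) {m : ℕ} (hm : 1 ≤ m) :
    ∃ (g : ℝ → Fin m) (mid : Fin m → ℝ), ∀ x, |x - c| ≤ b → |x - mid (g x)| ≤ b / m := by
  have hm0 : (0 : ℝ) < m := by exact_mod_cast hm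
  obtain ⟨l, hl⟩ : ∃ l, l = b / m := ⟨_, rfl⟩
  have hbl : b = m * l := by rw [hl]; field_simp
  have hl0 : 0 ≤ l := by rw [hl]; positivity
  rw [← hl]
  refine ⟨fun x => ⟨min (m - 1) ⌊(x - (c - b)) / (2 * l)⌋₊, by omega⟩,
    fun j => c - b + (2 * j + 1) * l, fun x hx => ?_⟩
  rw [abs_le] at hx
  rcases hl0.eq_or_lt with h0 | h0
  · have hb0 : b = 0 := by rw [hbl, ← h0, mul_zero]
    have hxc : x = c := by linarith [hx.1, hx.2]
    simp [← h0, hb0, hxc]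
  set u := (x - (c - b)) / (2 * l) with hu
  have hxu : x = c - b + u * (2 * l) := by rw [hu]; field_simp; ring
  have hu0 : 0 ≤ u := div_nonneg (by linarith) (by linarith)
  have hum : u ≤ m := by
    rw [hu, div_le_iff₀ (by linarith)]; linarith
  have h1 : (⌊u⌋₊ : ℝ) ≤ u := Nat.floor_le hu0
  have h2 : u < ⌊u⌋₊ + 1 := Nat.lt_floor_add_one u
  have key : ∃ j : ℕ, j = min (m - 1) ⌊u⌋₊ ∧ (j : ℝ) ≤ u ∧ u ≤ j + 1 := by
    refine ⟨_, rfl, ?_, ?_⟩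
    · refine le_trans ?_ h1
      exact_mod_cast min_le_right _ _
    · rcases le_total (m - 1) ⌊u⌋₊ with h | h
      · rw [min_eq_left h, Nat.cast_sub hm]; push_cast; linarith
      · rw [min_eq_right h]; exact h2.le
  obtain ⟨j, hj, hj1, hj2⟩ := key
  have hdiff : x - (c - b + (2 * j + 1) * l) = (2 * (u - j) - 1) * l := by
    conv_lhs => rw [hxu]
    ring
  change |x - (c - b + (2 * ((min (m - 1) ⌊u⌋₊ : ℕ) : ℝ) + 1) * l)| ≤ l
  rw [← hj, hdiff, abs_mul, abs_of_pos h0]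
  have : |2 * (u - j) - 1| ≤ 1 := abs_le.2 ⟨by linarith, by linarith⟩
  nlinarith

/-- An interval of half-length `b` contains at most `⌊2 b⌋ + 1` natural numbers. -/
lemma exists_injOn_fin (c b : ℝ) :
    ∃ g : ℕ → Fin (⌊2 * b⌋₊ + 1), ∀ n n' : ℕ, |(n : ℝ) - c| ≤ b → |(n' : ℝ) - c| ≤ b →
      g n = g n' → n = n' := by
  refine ⟨fun n => Fin.ofNat _ (n - ⌈c - b⌉₊), fun n n' hn hn' h => ?_⟩
  have key : ∀ n : ℕ, |(n : ℝ) - c| ≤ b → ⌈c - b⌉₊ ≤ n ∧ n - ⌈c - b⌉₊ < ⌊2 * b⌋₊ + 1 := by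
    intro n hn
    rw [abs_le] at hn
    have h1 : ⌈c - b⌉₊ ≤ n := Nat.ceil_le.2 (by linarith)
    refine ⟨h1, Nat.lt_succ_of_le (Nat.le_floor ?_)⟩
    rw [Nat.cast_sub h1]
    have := Nat.le_ceil (c - b)
    linarith
  obtain ⟨a1, a2⟩ := key n hn
  obtain ⟨b1, b2⟩ := key n' hn'
  have := congrArg Fin.val h
  simp only [Fin.ofNat, Nat.mod_eq_of_lt a2, Nat.mod_eq_of_lt b2] at this
  omega

/-- Twice the variance is the mean square distance of two independent copies. -/
lemma sum_mul_sum_mul_sq_sub_le {S : Type*} (F : Finset S) (p u : S → ℝ) (hp : ∀ s, 0 ≤ p s)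
    {l : ℝ} (hu : ∀ s ∈ F, |u s| ≤ l) :
    ∑ t ∈ F, p t * ∑ s ∈ F, p s * (u s - u t) ^ 2 ≤ 2 * l ^ 2 * (∑ s ∈ F, p s) ^ 2 := by
  have hexpand : ∑ t ∈ F, p t * ∑ s ∈ F, p s * (u s - u t) ^ 2 =
      2 * ((∑ s ∈ F, p s) * ∑ s ∈ F, p s * u s ^ 2) - 2 * (∑ s ∈ F, p s * u s) ^ 2 := by
    have h : ∀ t, p t * ∑ s ∈ F, p s * (u s - u t) ^ 2 =
        p t * ∑ s ∈ F, p s * u s ^ 2 - 2 * (p t * u t) * ∑ s ∈ F, p s * u s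
          + p t * u t ^ 2 * ∑ s ∈ F, p s := fun t => by
      simp only [Finset.mul_sum]
      rw [← Finset.sum_sub_distrib, ← Finset.sum_add_distrib]
      exact Finset.sum_congr rfl fun s _ => by ring
    simp_rw [h]
    rw [Finset.sum_add_distrib, Finset.sum_sub_distrib, ← Finset.sum_mul, ← Finset.sum_mul,
      ← Finset.sum_mul, ← Finset.mul_sum]
    ring
  have hP : 0 ≤ ∑ s ∈ F, p s := Finset.sum_nonneg fun s _ => hp s
  have h2 : ∑ s ∈ F, p s * u s ^ 2 ≤ (∑ s ∈ F, p s) * l ^ 2 := by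
    rw [Finset.sum_mul]
    refine Finset.sum_le_sum fun s hs => mul_le_mul_of_nonneg_left ?_ (hp s)
    rw [← sq_abs]
    have := hu s hs
    gcongr
  rw [hexpand]
  nlinarith [mul_le_mul_of_nonneg_left h2 hP, sq_nonneg (∑ s ∈ F, p s * u s)]

/-- In a box of half-length `l` some member of a weighted family has mean square distance at most
`2 l ^ 2` per coordinate to the family. A random member achieves this on average, which is half of
what the diameter of the box gives. -/
lemma exists_mean_sq_dist_le {S ι : Type*} [Fintype ι] (F : Finset S) (hF : F.Nonempty)
    (p : S → ℝ) (hp : ∀ s, 0 ≤ p s) (x : S → ι → ℝ) (mid : ι → ℝ) {l : ℝ}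
    (hx : ∀ s ∈ F, ∀ a, |x s a - mid a| ≤ l) :
    ∃ t, ∑ s ∈ F, p s * ∑ a, (x s a - x t a) ^ 2 ≤
      2 * Fintype.card ι * l ^ 2 * ∑ s ∈ F, p s := by
  set C := 2 * Fintype.card ι * l ^ 2 * ∑ s ∈ F, p s with hC
  by_cases hP : ∃ t ∈ F, 0 < p t
  swap
  · push Not at hP
    have h0 : ∀ s ∈ F, p s = 0 := fun s hs => le_antisymm (hP s hs) (hp s)
    obtain ⟨t, -⟩ := hF
    refine ⟨t, ?_⟩
    rw [Finset.sum_eq_zero fun s hs => by rw [h0 s hs, zero_mul], hC, Finset.sum_eq_zero h0,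
      mul_zero]
  by_contra! hcon
  have hlt : ∑ t ∈ F, p t * C < ∑ t ∈ F, p t * ∑ s ∈ F, p s * ∑ a, (x s a - x t a) ^ 2 := by
    refine Finset.sum_lt_sum (fun t _ => mul_le_mul_of_nonneg_left (hcon t).le (hp t)) ?_
    obtain ⟨t, ht, hpt⟩ := hP
    exact ⟨t, ht, mul_lt_mul_of_pos_left (hcon t) hpt⟩
  have hswap : ∑ t ∈ F, p t * ∑ s ∈ F, p s * ∑ a, (x s a - x t a) ^ 2 =
      ∑ a, ∑ t ∈ F, p t * ∑ s ∈ F, p s * ((x s a - mid a) - (x t a - mid a)) ^ 2 := by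
    rw [Finset.sum_comm]
    refine Finset.sum_congr rfl fun t _ => ?_
    rw [← Finset.mul_sum, Finset.sum_comm]
    simp only [Finset.mul_sum, sub_sub_sub_cancel_right]
  have hle : ∑ a, ∑ t ∈ F, p t * ∑ s ∈ F, p s * ((x s a - mid a) - (x t a - mid a)) ^ 2 ≤
      ∑ _a : ι, 2 * l ^ 2 * (∑ s ∈ F, p s) ^ 2 :=
    Finset.sum_le_sum fun a _ => sum_mul_sum_mul_sq_sub_le F p (fun s => x s a - mid a) hp
      fun s hs => hx s hs a
  rw [hswap, ← Finset.sum_mul] at hlt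
  rw [Finset.sum_const, Finset.card_univ, nsmul_eq_mul] at hle
  have : (∑ t ∈ F, p t) * C = Fintype.card ι * (2 * l ^ 2 * (∑ s ∈ F, p s) ^ 2) := by
    rw [hC]; ring
  linarith

/-- A choice of representatives of the cells of `q` that has small mean square distance. The
representatives may depend on the weights `p`. -/
lemma exists_representatives {S κ ι : Type*} [Nonempty S] [Fintype κ] [Fintype ι]
    (F : Finset S) (p : S → ℝ) (hp : ∀ s, 0 ≤ p s) (q : S → κ) (x : S → ι → ℝ)
    (mid : κ → ι → ℝ) {l : ℝ} (hx : ∀ s ∈ F, ∀ a, |x s a - mid (q s) a| ≤ l) :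
    ∃ r : κ → S, ∑ s ∈ F, p s * ∑ a, (x s a - x (r (q s)) a) ^ 2 ≤
      2 * Fintype.card ι * l ^ 2 * ∑ s ∈ F, p s := by
  classical
  have hex : ∀ k, ∃ t, ∑ s ∈ F with q s = k, p s * ∑ a, (x s a - x t a) ^ 2 ≤
      2 * Fintype.card ι * l ^ 2 * ∑ s ∈ F with q s = k, p s := fun k => by
    rcases (F.filter (fun s => q s = k)).eq_empty_or_nonempty with h | h
    · exact ⟨Classical.arbitrary S, by simp [h]⟩
    · refine exists_mean_sq_dist_le _ h p hp x (mid k) fun s hs a => ?_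
      obtain ⟨h1, h2⟩ := Finset.mem_filter.1 hs
      rw [← h2]
      exact hx s h1 a
  choose r hr using hex
  refine ⟨r, ?_⟩
  rw [← Finset.sum_fiberwise F q, ← Finset.sum_fiberwise F q p, Finset.mul_sum]
  refine Finset.sum_le_sum fun k _ => le_trans (le_of_eq ?_) (hr k)
  refine Finset.sum_congr rfl fun s hs => ?_
  rw [(Finset.mem_filter.1 hs).2]

/-- Cells that meet `T` can be represented by members of `T`. -/
lemma exists_representatives_mem {S κ : Type*} [Nonempty S] (T : Set S) (q : S → κ) :
    ∃ r : κ → S, ∀ s ∈ T, r (q s) ∈ T ∧ q (r (q s)) = q s := by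
  classical
  have hex : ∀ k, ∃ t, (∃ s ∈ T, q s = k) → t ∈ T ∧ q t = k := fun k => by
    by_cases h : ∃ s ∈ T, q s = k
    · obtain ⟨s, hs⟩ := h
      exact ⟨s, fun _ => hs⟩
    · exact ⟨Classical.arbitrary S, fun h' => absurd h' h⟩
  choose r hr using hex
  exact ⟨r, fun s hs => hr (q s) ⟨s, hs, rfl⟩⟩

/-! ### The bounds on the mutual information -/

open Classical in
/-- The covering bound when representatives are good only on average over a set `T`, and arbitrary
outside. -/
lemma mutualInfo_le_of_cover_on {Ω S 𝓦 κ : Type*} [MeasurableSpace Ω] [Fintype S]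
    [MeasurableSpace S] [MeasurableSingletonClass S] [MeasurableSpace 𝓦] [Fintype κ]
    (P : Measure Ω) [IsProbabilityMeasure P] (X : Ω → S) (W : Ω → 𝓦)
    (A : Kernel S 𝓦) [IsMarkovKernel A] (hW : HasCondDistrib W X A P)
    (q : S → κ) (r : κ → S) (c : S → S → ℝ) (hc0 : ∀ s s', 0 ≤ c s s')
    (hc : ∀ s s', klDiv (A s) (A s') ≤ ENNReal.ofReal (c s s'))
    {M : ℝ} (hM : ∀ s s', c s s' ≤ M) (T : Set S) {D δ : ℝ}
    (hD : ∑ s with s ∈ T, (P.map X).real {s} * c s (r (q s)) ≤ D)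
    (hδ : (P.map X).real Tᶜ ≤ δ) :
    mutualInfo X W P ≤ ENNReal.ofReal (Real.log (Fintype.card κ) + (D + M * δ)) := by
  refine (mutualInfo_le_of_cover P X W A hW q r (fun s => c s (r (q s))) (fun s => hc0 _ _)
    fun s => hc _ _).trans (ENNReal.ofReal_le_ofReal ?_)
  have hX := hW.aemeasurable_fst
  obtain ⟨ω⟩ := nonempty_of_isProbabilityMeasure P
  have hM0 : 0 ≤ M := (hc0 (X ω) (X ω)).trans (hM _ _)
  have hout : ∑ s with s ∉ T, (P.map X).real {s} * c s (r (q s)) ≤ M * δ := by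
    calc ∑ s with s ∉ T, (P.map X).real {s} * c s (r (q s))
        ≤ ∑ s with s ∉ T, (P.map X).real {s} * M :=
          Finset.sum_le_sum fun s _ => mul_le_mul_of_nonneg_left (hM _ _) measureReal_nonneg
      _ = M * (P.map X).real Tᶜ := by
          have : IsProbabilityMeasure (P.map X) := Measure.isProbabilityMeasure_map hX
          rw [← Finset.sum_mul, sum_measureReal_singleton, mul_comm]
          congr 2
          ext s; simp
      _ ≤ M * δ := by gcongr
  have hsplit := Finset.sum_filter_add_sum_filter_not Finset.univ (fun s => s ∈ T)
    (fun s => (P.map X).real {s} * c s (r (q s)))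
  have hcomm : ∑ s, c s (r (q s)) * (P.map X).real {s} =
      ∑ s, (P.map X).real {s} * c s (r (q s)) := Finset.sum_congr rfl fun _ _ => mul_comm _ _
  rw [hcomm, ← hsplit]
  linarith

section Bounds

variable {Ω 𝓩 𝓦 : Type*} [MeasurableSpace Ω]
    [Fintype 𝓩] [MeasurableSpace 𝓩] [MeasurableSingletonClass 𝓩] [MeasurableSpace 𝓦]
    (P : Measure Ω) [IsProbabilityMeasure P]
    (PZ : Measure 𝓩)
    {N : ℕ} (X : Ω → Fin N → 𝓩)
    (A : Kernel (Fin N → 𝓩) 𝓦) [IsMarkovKernel A]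
    (W : Ω → 𝓦)

/-- Covering typical datasets by one representative for each vector of symbol counts. -/
lemma mutualInfo_le_of_count_cover (hW : HasCondDistrib W X A P) {b : ℝ} (hb : 0 ≤ b) {δ : ℝ}
    (hδ : (P.map X).real (typicalSet PZ N b)ᶜ ≤ δ)
    (c : (Fin N → 𝓩) → (Fin N → 𝓩) → ℝ) (hc0 : ∀ s s', 0 ≤ c s s')
    (hc : ∀ s s', klDiv (A s) (A s') ≤ ENNReal.ofReal (c s s'))
    (hdist : ∀ s s', datasetDist s s' = 0 → c s s' = 0)
    {M : ℝ} (hM : ∀ s s', c s s' ≤ M) :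
    mutualInfo X W P ≤
      ENNReal.ofReal (Fintype.card 𝓩 * Real.log (1 + 2 * b) + M * δ) := by
  classical
  obtain ⟨ω⟩ := nonempty_of_isProbabilityMeasure P
  have : Nonempty (Fin N → 𝓩) := ⟨X ω⟩
  have : IsProbabilityMeasure (P.map X) := Measure.isProbabilityMeasure_map hW.aemeasurable_fst
  choose g hg using fun a => exists_injOn_fin (N * PZ.real {a}) b
  set q : (Fin N → 𝓩) → 𝓩 → Fin (⌊2 * b⌋₊ + 1) := fun s a => g a (symbolCount s a) with hq
  obtain ⟨r, hr⟩ := exists_representatives_mem (typicalSet PZ N b) q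
  refine (mutualInfo_le_of_cover_on P X W A hW q r c hc0 hc hM (typicalSet PZ N b) (D := 0)
    (Finset.sum_nonpos fun s hs => ?_) hδ).trans (ENNReal.ofReal_le_ofReal ?_)
  · have hs' : s ∈ typicalSet PZ N b := (Finset.mem_filter.1 hs).2
    obtain ⟨h1, h2⟩ := hr s hs'
    have heq : ∀ a, symbolCount (r (q s)) a = symbolCount s a := fun a =>
      hg a _ _ (h1 a) (hs' a) (congrFun h2 a)
    rw [hdist _ _ (by simp [datasetDist, heq]), mul_zero]
  · have hle : Real.log ((⌊2 * b⌋₊ + 1 : ℕ) : ℝ) ≤ Real.log (1 + 2 * b) := by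
      refine Real.log_le_log (by positivity) ?_
      have := Nat.floor_le (by positivity : 0 ≤ 2 * b)
      push_cast; linarith
    rw [Fintype.card_fun, Fintype.card_fin, Nat.cast_pow, Real.log_pow]
    have := mul_le_mul_of_nonneg_left hle (Nat.cast_nonneg (α := ℝ) (Fintype.card 𝓩))
    linarith

/-- Covering typical datasets by cubes, with any representative of each cube. -/
lemma mutualInfo_le_of_linear_cost (hW : HasCondDistrib W X A P) {b : ℝ} (hb : 0 ≤ b) {δ : ℝ}
    (hδ : (P.map X).real (typicalSet PZ N b)ᶜ ≤ δ) {ε : ℝ} (hε : 0 ≤ ε)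
    (hc : ∀ s s', klDiv (A s) (A s') ≤ ENNReal.ofReal (ε * datasetDist s s')) :
    mutualInfo X W P ≤
      ENNReal.ofReal (Fintype.card 𝓩 * Real.log (1 + Real.exp 1 * ε * b) + ε * N * δ) := by
  classical
  obtain ⟨ω⟩ := nonempty_of_isProbabilityMeasure P
  have : Nonempty (Fin N → 𝓩) := ⟨X ω⟩
  have : IsProbabilityMeasure (P.map X) := Measure.isProbabilityMeasure_map hW.aemeasurable_fst
  obtain ⟨m, hm1, hm⟩ := exists_log_add_div_le (mul_nonneg hε hb)
  have hm0 : (0 : ℝ) < m := by exact_mod_cast hm1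
  choose g mid hg using fun a => exists_cells (N * PZ.real {a}) hb hm1
  set q : (Fin N → 𝓩) → 𝓩 → Fin m := fun s a => g a (symbolCount s a) with hq
  obtain ⟨r, hr⟩ := exists_representatives_mem (typicalSet PZ N b) q
  set d : ℝ := (Fintype.card 𝓩 : ℝ) with hd
  have hdist : ∀ s ∈ typicalSet PZ N b, datasetDist s (r (q s)) ≤ d * (b / m) := by
    intro s hs
    obtain ⟨h1, h2⟩ := hr s hs
    have hterm : ∀ a, |(symbolCount s a : ℝ) - symbolCount (r (q s)) a| ≤ 2 * (b / m) := by
      intro a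
      have e1 := hg a _ (hs a)
      have e2 := hg a _ (h1 a)
      have e3 : g a (symbolCount (r (q s)) a) = g a (symbolCount s a) := congrFun h2 a
      rw [e3] at e2
      rw [abs_le] at e1 e2 ⊢
      constructor <;> linarith [e1.1, e1.2, e2.1, e2.2]
    have := Finset.sum_le_sum fun a (_ : a ∈ Finset.univ) => hterm a
    rw [Finset.sum_const, Finset.card_univ, nsmul_eq_mul] at this
    rw [datasetDist]
    linarith
  refine (mutualInfo_le_of_cover_on P X W A hW q r (fun s s' => ε * datasetDist s s')
    (fun s s' => mul_nonneg hε (datasetDist_nonneg s s')) hc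
    (fun s s' => mul_le_mul_of_nonneg_left (datasetDist_le s s') hε) (typicalSet PZ N b)
    (D := ε * (d * (b / m))) ?_ hδ).trans (ENNReal.ofReal_le_ofReal ?_)
  · calc _ ≤ ∑ s with s ∈ typicalSet PZ N b, (P.map X).real {s} * (ε * (d * (b / m))) :=
          Finset.sum_le_sum fun s hs => mul_le_mul_of_nonneg_left
            (mul_le_mul_of_nonneg_left (hdist s (Finset.mem_filter.1 hs).2) hε) measureReal_nonneg
      _ ≤ 1 * (ε * (d * (b / m))) := by
          rw [← Finset.sum_mul, sum_measureReal_singleton]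
          exact mul_le_mul_of_nonneg_right measureReal_le_one (by positivity)
      _ = _ := one_mul _
  · rw [Fintype.card_fun, Fintype.card_fin, Nat.cast_pow, Real.log_pow, ← hd]
    have h := mul_le_mul_of_nonneg_left hm (Nat.cast_nonneg (α := ℝ) (Fintype.card 𝓩))
    rw [← hd, ← mul_assoc] at h
    have : d * (Real.log m + ε * b / m) = d * Real.log m + ε * (d * (b / m)) := by ring
    linarith

/-- Covering typical datasets by cubes, with representatives that are close in mean square. -/
lemma mutualInfo_le_of_quadratic_cost (hW : HasCondDistrib W X A P) {b : ℝ} (hb : 0 ≤ b) {δ : ℝ}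
    (hδ : (P.map X).real (typicalSet PZ N b)ᶜ ≤ δ) (μ : ℝ)
    (hc : ∀ s s', klDiv (A s) (A s') ≤ ENNReal.ofReal (μ ^ 2 / 2 * datasetDist s s' ^ 2)) :
    mutualInfo X W P ≤
      ENNReal.ofReal (Fintype.card 𝓩 / 2 *
        Real.log (1 + Real.exp 1 * (Fintype.card 𝓩 * μ ^ 2 * b ^ 2)) + μ ^ 2 / 2 * N ^ 2 * δ) := by
  classical
  obtain ⟨ω⟩ := nonempty_of_isProbabilityMeasure P
  have : Nonempty (Fin N → 𝓩) := ⟨X ω⟩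
  have : IsProbabilityMeasure (P.map X) := Measure.isProbabilityMeasure_map hW.aemeasurable_fst
  set d : ℝ := (Fintype.card 𝓩 : ℝ) with hd
  have hd0 : 0 ≤ d := Nat.cast_nonneg _
  obtain ⟨m, hm1, hm⟩ := exists_two_mul_log_add_div_sq_le
    (by positivity : 0 ≤ d * μ ^ 2 * b ^ 2 / 2)
  have hm0 : (0 : ℝ) < m := by exact_mod_cast hm1
  choose g mid hg using fun a => exists_cells (N * PZ.real {a}) hb hm1
  set q : (Fin N → 𝓩) → 𝓩 → Fin m := fun s a => g a (symbolCount s a) with hq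
  obtain ⟨r, hr⟩ := exists_representatives
    (Finset.univ.filter fun s => s ∈ typicalSet PZ N b) (fun s => (P.map X).real {s})
    (fun s => measureReal_nonneg) q (fun s a => (symbolCount s a : ℝ)) (fun k a => mid a (k a))
    (l := b / m) fun s hs a => hg a _ ((Finset.mem_filter.1 hs).2 a)
  refine (mutualInfo_le_of_cover_on P X W A hW q r (fun s s' => μ ^ 2 / 2 * datasetDist s s' ^ 2)
    (fun s s' => by positivity) hc (M := μ ^ 2 / 2 * N ^ 2)
    (fun s s' => mul_le_mul_of_nonneg_left
      (pow_le_pow_left₀ (datasetDist_nonneg s s') (datasetDist_le s s') 2) (by positivity))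
    (typicalSet PZ N b)
    (D := μ ^ 2 / 2 * (d / 4) * (2 * d * (b / m) ^ 2)) ?_ hδ).trans (ENNReal.ofReal_le_ofReal ?_)
  · calc _ ≤ ∑ s with s ∈ typicalSet PZ N b, μ ^ 2 / 2 * (d / 4) * ((P.map X).real {s} *
            ∑ a, ((symbolCount s a : ℝ) - symbolCount (r (q s)) a) ^ 2) := by
          refine Finset.sum_le_sum fun s _ => ?_
          have := mul_le_mul_of_nonneg_left (mul_le_mul_of_nonneg_left
            (datasetDist_sq_le s (r (q s))) (by positivity : 0 ≤ μ ^ 2 / 2))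
            (measureReal_nonneg (μ := P.map X) (s := {s}))
          refine this.trans (le_of_eq ?_)
          ring
      _ ≤ μ ^ 2 / 2 * (d / 4) * (2 * d * (b / m) ^ 2 * 1) := by
          rw [← Finset.mul_sum]
          refine mul_le_mul_of_nonneg_left (hr.trans ?_) (by positivity)
          rw [sum_measureReal_singleton]
          exact mul_le_mul_of_nonneg_left measureReal_le_one (by positivity)
      _ = _ := by rw [mul_one]
  · rw [Fintype.card_fun, Fintype.card_fin, Nat.cast_pow, Real.log_pow, ← hd]
    have h := mul_le_mul_of_nonneg_left hm (by positivity : 0 ≤ d / 2)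
    rw [mul_div_cancel₀ _ (two_ne_zero)] at h
    have : d / 2 * (2 * Real.log m + d * μ ^ 2 * b ^ 2 / 2 / m ^ 2) =
        d * Real.log m + μ ^ 2 / 2 * (d / 4) * (2 * d * (b / m) ^ 2) := by
      field_simp; ring
    linarith

end Bounds

end PrivateLearning

theorem mainTheorem3 {Ω 𝓩 𝓦 : Type*} [MeasurableSpace Ω]
    [Fintype 𝓩] [MeasurableSpace 𝓩] [MeasurableSingletonClass 𝓩] [MeasurableSpace 𝓦]
    (P : Measure Ω) [IsProbabilityMeasure P]
    (PZ : Measure 𝓩) [IsProbabilityMeasure PZ]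
    (N : ℕ) (hN : 1 ≤ N)
    (Z : Fin N → Ω → 𝓩) (hZ_law : ∀ i, HasLaw (Z i) PZ P) (hZ_indep : iIndepFun Z P)
    (A : Kernel (Fin N → 𝓩) 𝓦) [IsMarkovKernel A] (hA : PrivateLearning.PermutationInvariant A)
    (W : Ω → 𝓦) (hW : HasCondDistrib W (fun ω i => Z i ω) A P) :
    (∀ ε : ℝ, 0 ≤ ε → PrivateLearning.IsDP A ε →
      (ε ≤ 2 →
        PrivateLearning.mutualInfo (fun ω i => Z i ω) W P ≤ ENNReal.ofReal
          ((Fintype.card 𝓩 : ℝ) * Real.log (1 + Real.exp 1 * ε * √((N : ℝ) * Real.log N))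
            + 2 * (Fintype.card 𝓩 : ℝ) * (ε / N))) ∧
      (2 < ε →
        PrivateLearning.mutualInfo (fun ω i => Z i ω) W P ≤ ENNReal.ofReal
          ((Fintype.card 𝓩 : ℝ) * Real.log (1 + 2 * √((N : ℝ) * Real.log N))
            + 2 * (Fintype.card 𝓩 : ℝ) * (ε / N)))) ∧
    (∀ μ : ℝ, 0 ≤ μ → PrivateLearning.IsGDP A μ →
      (μ ≤ 2 / √(Fintype.card 𝓩 : ℝ) →
        PrivateLearning.mutualInfo (fun ω i => Z i ω) W P ≤ ENNReal.ofReal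
          ((Fintype.card 𝓩 : ℝ) / 2 *
              Real.log (1 + Real.exp 1 * (Fintype.card 𝓩 : ℝ) * μ ^ 2 * N * Real.log N)
            + (Fintype.card 𝓩 : ℝ) * μ ^ 2)) ∧
      (2 / √(Fintype.card 𝓩 : ℝ) < μ →
        PrivateLearning.mutualInfo (fun ω i => Z i ω) W P ≤ ENNReal.ofReal
          ((Fintype.card 𝓩 : ℝ) * Real.log (1 + 2 * √((N : ℝ) * Real.log N))
            + (Fintype.card 𝓩 : ℝ) * μ ^ 2))) := by
  have hN0 : (0 : ℝ) < N := by exact_mod_cast hN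
  have hb2 : √((N : ℝ) * Real.log N) ^ 2 = N * Real.log N :=
    Real.sq_sqrt (mul_nonneg hN0.le (Real.log_nonneg (by exact_mod_cast hN)))
  have hb := Real.sqrt_nonneg ((N : ℝ) * Real.log N)
  have hδ := PrivateLearning.measure_compl_typicalSet_le P PZ hN Z hZ_law hZ_indep
  refine ⟨fun ε hε hDP => ?_, fun μ hμ hGDP => ?_⟩
  · have hkl := hDP.klDiv_le hA hε
    -- an atypical dataset costs at most `ε * N`
    have hrest : ε * N * (2 * Fintype.card 𝓩 / (N : ℝ) ^ 2) =
        2 * (Fintype.card 𝓩 : ℝ) * (ε / N) := by field_simp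
    rw [← hrest]
    refine ⟨fun _ => ?_, fun _ => ?_⟩
    · exact PrivateLearning.mutualInfo_le_of_linear_cost P PZ _ A W hW hb hδ hε hkl
    · exact PrivateLearning.mutualInfo_le_of_count_cover P PZ _ A W hW hb hδ _
        (fun s s' => mul_nonneg hε (PrivateLearning.datasetDist_nonneg s s')) hkl
        (fun s s' h => by rw [h, mul_zero])
        (fun s s' => mul_le_mul_of_nonneg_left (PrivateLearning.datasetDist_le s s') hε)
  · have hkl := hGDP.klDiv_le hA hμ
    -- an atypical dataset costs at most `μ ^ 2 * N ^ 2 / 2`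
    have hrest : μ ^ 2 / 2 * N ^ 2 * (2 * Fintype.card 𝓩 / (N : ℝ) ^ 2) =
        (Fintype.card 𝓩 : ℝ) * μ ^ 2 := by field_simp
    rw [← hrest]
    refine ⟨fun _ => ?_, fun _ => ?_⟩
    · have hrw : Real.exp 1 * (Fintype.card 𝓩 : ℝ) * μ ^ 2 * N * Real.log N =
          Real.exp 1 * (Fintype.card 𝓩 * μ ^ 2 * √((N : ℝ) * Real.log N) ^ 2) := by
        rw [hb2]; ring
      rw [hrw]
      exact PrivateLearning.mutualInfo_le_of_quadratic_cost P PZ _ A W hW hb hδ μ hkl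
    · exact PrivateLearning.mutualInfo_le_of_count_cover P PZ _ A W hW hb hδ _
        (fun s s' => by positivity) hkl (fun s s' h => by rw [h]; ring)
        (fun s s' => mul_le_mul_of_nonneg_left
          (pow_le_pow_left₀ (PrivateLearning.datasetDist_nonneg s s')
            (PrivateLearning.datasetDist_le s s') 2) (by positivity))
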